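/- **Conventions.** An $AW^*$-algebra is a unital $C^*$-algebra in which the right annihilator of every subset is of the form $pN$ for a projection $p$; it is finite if $v^*v=1$ implies $vv^*=1$. A $1$-quasitrace on a $C^*$-algebra $A$ is a function $\tau:A\to\mathbb C$ such that $\tau(x^*x)=\tau(xx^*)\ge 0$ for all $x\in A$, $\tau(a+ib)=\tau(a)+i\tau(b)$ for all self-adjoint $a,b\in A$, and $\tau$ is linear on every abelian $C^*$-subalgebra of $A$. A quasitrace on a unital $C^*$-algebra $A$ is a $1$-quasitrace $\tau$ on $A$ for which there is a $1$-quasitrace $\tau_2$ on $M_2(A)$ with $\tau(x)=\tau_2(x\otimes e_{11})$ for all $x\in A$. It is faithful if $\tau(x^*x)=0$ implies $x=0$, and normal if $\tau(\bigvee_{i\in I} p_i)=\sum_{i\in I}\tau(p_i)$ for every orthogonal set of projections $(p_i)_{i\in I}$ whose least upper bound exists in the projection lattice (in an $AW^*$-algebra it always exists). An $AW^*$-subalgebra of an $AW^*$-algebra $N$ is here a $C^*$-subalgebra containing the unit of $N$ which is itself an $AW^*$-algebra and which contains the supremum, computed in the projection lattice of $N$, of each of its orthogonal sets of projections. The $AW^*$-subalgebra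 generated by $A\subseteq N$ is the intersection of all $AW^*$-subalgebras of $N$ containing $A$. The norm $\|\cdot\|_{\min}$ is the minimal (spatial) $C^*$-tensor norm on the algebraic tensor product of two $C^*$-algebras, and $\otimes$ between $C^*$-algebras denotes the completion in this norm. A $C^*$-algebra $C$ is exact if, for every $C^*$-algebra $D$ and every closed two-sided ideal $J$ of $D$, the sequence $0\to C\otimes J\to C\otimes D\to C\otimes (D/J)\to 0$ is exact. **Lemma 5.8.** Let $N$ be a finite $AW^*$-algebra with a faithful normal quasitrace $\tau$, and let $A$ and $C$ be two commuting $C^*$-subalgebras of $N$, both containing the unit of $N$. Let $B$ be the $AW^*$-subalgebra of $N$ generated by $A$. Suppose that (i) $\bigl\|\sum_{i=1}^{\ell} a_ic_i\bigr\|\le \bigl\|\sum_{i=1}^{\ell} a_i\otimes c_i\bigr\|_{\min}$ for all $\ell\in\mathbb N$, $a_1,\dots,a_\ell\in A$, $c_1,\dots,c_\ell\in C$ (minimal norm of $A\otimes C$), and (ii) $C$ is an exact $C^*$-algebra. Then $$\Bigl\|\sum_{i=1}^{\ell} b_ic_i\Bigr\|\le \Bigl\|\sum_{i=1}^{\ell}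 b_i\otimes c_i\Bigr\|_{\min}\qquad\text{for all }\ell\in\mathbb N,\ b_1,\dots,b_\ell\in B,\ c_1,\dots,c_\ell\in C$$ (minimal norm of $B\otimes C$). -/

import Mathlib

open scoped TensorProduct ComplexOrder

universe u

noncomputable section

/-! ### Finite AW*-algebras and AW*-subalgebras -/

/-- A *-ring is a Baer *-ring if the right annihilator of every subset is the principal right ideal
generated by a projection. An AW*-algebra is a unital C*-algebra which is a Baer *-ring. -/
def IsBaerStarRing (R : Type*) [Ring R] [StarRing R] : Prop :=
  ∀ S : Set R, ∃ p : R, IsStarProjection p ∧ ∀ x : R, (∀ s ∈ S, s * x = 0) ↔ ∃ y, x = p * y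

/-- Finiteness of a *-ring with unit: every isometry is a unitary. -/
def IsFiniteStarRing (R : Type*) [Ring R] [StarRing R] : Prop :=
  ∀ v : R, star v * v = 1 → v * star v = 1

/-- `P` is a set of pairwise orthogonal projections. -/
def IsOrthogonalProjectionSet {R : Type*} [NonUnitalRing R] [StarRing R] (P : Set R) : Prop :=
  (∀ p ∈ P, IsStarProjection p) ∧ ∀ p ∈ P, ∀ q ∈ P, p ≠ q → p * q = 0

/-- `e` is the least upper bound of the set `P` of projections, in the partially ordered set of
projections of `R` (where `p ≤ q` means `p * q = p`). -/
def IsProjectionSup {R : Type*} [NonUnitalRing R] [StarRing R] (P : Set R) (e : R) : Prop :=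
  IsStarProjection e ∧ (∀ p ∈ P, p * e = p) ∧
    ∀ f : R, IsStarProjection f → (∀ p ∈ P, p * f = p) → e * f = e

/-- `S` is a (unital) AW*-subalgebra of the AW*-algebra `N`: it is a C*-subalgebra, it is an
AW*-algebra in its own right, and it contains the supremum, computed in `N`, of every set of
orthogonal projections of `S`. -/
def IsAWStarSubalgebra {N : Type*} [CStarAlgebra N] (S : StarSubalgebra ℂ N) : Prop :=
  IsClosed (S : Set N) ∧ IsBaerStarRing S ∧
    ∀ P : Set N, P ⊆ (S : Set N) → IsOrthogonalProjectionSet P →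
      ∀ e : N, IsProjectionSup P e → e ∈ S

/-- The AW*-subalgebra of `N` generated by `A`: the intersection of all AW*-subalgebras of `N`
that contain `A`. -/
def awStarClosure {N : Type*} [CStarAlgebra N] (A : StarSubalgebra ℂ N) : StarSubalgebra ℂ N :=
  sInf {S | IsAWStarSubalgebra S ∧ A ≤ S}

/-! ### Quasitraces -/

/-- 1-quasitraces on a C*-algebra `A`; only the *-algebra structure and the topology of `A` enter.
In the last clause `B` runs through the abelian C*-subalgebras of `A`. -/
structure IsOneQuasitrace {A : Type*} [NonUnitalRing A] [StarRing A] [Module ℂ A]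
    [TopologicalSpace A] (τ : A → ℂ) : Prop where
  star_mul_self : ∀ x, τ (star x * x) = τ (x * star x)
  star_mul_self_nonneg : ∀ x, 0 ≤ τ (star x * x)
  add_I_smul : ∀ a b, IsSelfAdjoint a → IsSelfAdjoint b →
    τ (a + Complex.I • b) = τ a + Complex.I * τ b
  linear_on_abelian : ∀ B : NonUnitalStarSubalgebra ℂ A, IsClosed (B : Set A) →
    (∀ x ∈ B, ∀ y ∈ B, x * y = y * x) →
      (∀ x ∈ B, ∀ y ∈ B, τ (x + y) = τ x + τ y) ∧ ∀ (c : ℂ), ∀ x ∈ B, τ (c • x) = c * τ x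

/-- Quasitraces (that is, 2-quasitraces). The C*-algebra of 2 × 2 matrices over `A` carries the
conjugate transpose as its involution, and its norm topology is the topology of entrywise
convergence, which is the one that `Matrix` has in Mathlib. -/
def IsQuasitrace {A : Type*} [CStarAlgebra A] (τ : A → ℂ) : Prop :=
  IsOneQuasitrace τ ∧ ∃ τ₂ : Matrix (Fin 2) (Fin 2) A → ℂ,
    IsOneQuasitrace τ₂ ∧ ∀ x, τ x = τ₂ (Matrix.single 0 0 x)

/-- Faithfulness of a quasitrace. -/
def IsFaithfulQuasitrace {A : Type*} [CStarAlgebra A] (τ : A → ℂ) : Prop :=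
  ∀ x, τ (star x * x) = 0 → x = 0

/-- Normality of a quasitrace: complete additivity on sets of orthogonal projections. -/
def IsNormalQuasitrace {A : Type*} [CStarAlgebra A] (τ : A → ℂ) : Prop :=
  ∀ P : Set A, IsOrthogonalProjectionSet P → ∀ e : A, IsProjectionSup P e →
    HasSum (fun p : P => τ p) (τ e)

/-! ### The minimal (spatial) tensor norm -/

/-- *-representations of a *-algebra on Hilbert spaces (possibly degenerate). -/
structure HilbertRep (A : Type u) [NonUnitalRing A] [StarRing A] [Module ℂ A] where
  space : Type u
  [normedAddCommGroup : NormedAddCommGroup space]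
  [innerProductSpace : InnerProductSpace ℂ space]
  [completeSpace : CompleteSpace space]
  rep : A →⋆ₙₐ[ℂ] (space →L[ℂ] space)

attribute [instance] HilbertRep.normedAddCommGroup HilbertRep.innerProductSpace
  HilbertRep.completeSpace

section MinTensor

variable {A B D : Type u}

/-- The representation `π ⊗ σ` of the algebraic tensor product. It is given on the algebraic tensor
product of the two Hilbert spaces, with its Hilbert tensor norm; this space is dense in the Hilbert
space tensor product, so operator norms are the same on both. -/
def HilbertRep.tensor [NonUnitalRing A] [StarRing A] [Module ℂ A]
    [NonUnitalRing B] [StarRing B] [Module ℂ B] (π : HilbertRep A) (σ : HilbertRep B) :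
    A ⊗[ℂ] B →ₗ[ℂ] ((π.space ⊗[ℂ] σ.space) →L[ℂ] (π.space ⊗[ℂ] σ.space)) :=
  TensorProduct.lift <| LinearMap.mk₂ ℂ (fun a b => TensorProduct.mapL (π.rep a) (σ.rep b))
    (fun a a' b => by rw [map_add, TensorProduct.mapL_add_left])
    (fun c a b => by rw [map_smul, TensorProduct.mapL_smul_left])
    (fun a b b' => by rw [map_add, TensorProduct.mapL_add_right])
    (fun c a b => by rw [map_smul, TensorProduct.mapL_smul_right])

/-- The minimal tensor norm on the algebraic tensor product of two C*-algebras: the supremum of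
`‖(π ⊗ σ)(x)‖` over all *-representations `π` of `A` and `σ` of `B` on Hilbert spaces. (Hilbert
spaces in the universe of the algebras suffice, since they include all GNS spaces.) -/
def minTensorNorm [NonUnitalRing A] [StarRing A] [Module ℂ A]
    [NonUnitalRing B] [StarRing B] [Module ℂ B] (x : A ⊗[ℂ] B) : ℝ :=
  ⨆ ρ : HilbertRep A × HilbertRep B, ‖ρ.1.tensor ρ.2 x‖

instance [NonUnitalRing A] [StarRing A] [Module ℂ A] : Nonempty (HilbertRep A) :=
  ⟨{ space := PUnit, rep := 0 }⟩

variable [NonUnitalCStarAlgebra A] [NonUnitalCStarAlgebra B] [NonUnitalCStarAlgebra D]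

theorem minTensorNorm_bddAbove (x : A ⊗[ℂ] B) :
    BddAbove (Set.range fun ρ : HilbertRep A × HilbertRep B => ‖ρ.1.tensor ρ.2 x‖) := by
  induction x using TensorProduct.induction_on with
  | zero =>
    refine ⟨0, ?_⟩
    rintro _ ⟨ρ, rfl⟩
    simp only [map_zero]
    exact ContinuousLinearMap.opNorm_zero.le
  | tmul a b =>
    refine ⟨‖a‖ * ‖b‖, ?_⟩
    rintro _ ⟨ρ, rfl⟩
    refine (TensorProduct.norm_mapL_le _ _).trans ?_
    exact mul_le_mul (NonUnitalStarAlgHom.norm_apply_le _ a)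
      (NonUnitalStarAlgHom.norm_apply_le _ b) (norm_nonneg _) (norm_nonneg _)
  | add x y hx hy =>
    obtain ⟨M, hM⟩ := hx
    obtain ⟨M', hM'⟩ := hy
    refine ⟨M + M', ?_⟩
    rintro _ ⟨ρ, rfl⟩
    have h1 : ‖ρ.1.tensor ρ.2 x‖ ≤ M := hM ⟨ρ, rfl⟩
    have h2 : ‖ρ.1.tensor ρ.2 y‖ ≤ M' := hM' ⟨ρ, rfl⟩
    simp only [map_add]
    exact (ContinuousLinearMap.opNorm_add_le _ _).trans (add_le_add h1 h2)

variable (A B) in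
/-- The minimal tensor norm as a seminorm on the additive group of the algebraic tensor product. -/
def minTensorSeminorm : AddGroupSeminorm (A ⊗[ℂ] B) where
  toFun := minTensorNorm
  map_zero' := by
    simp only [minTensorNorm, map_zero]
    exact (iSup_congr fun _ => ContinuousLinearMap.opNorm_zero).trans ciSup_const
  add_le' x y := by
    refine ciSup_le fun ρ => ?_
    rw [map_add]
    exact (ContinuousLinearMap.opNorm_add_le _ _).trans
      (add_le_add (le_ciSup (minTensorNorm_bddAbove x) ρ)
        (le_ciSup (minTensorNorm_bddAbove y) ρ))
  neg' x := by
    refine iSup_congr fun ρ => ?_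
    rw [map_neg]
    exact norm_neg (ρ.1.tensor ρ.2 x)

variable (A B) in
/-- The algebraic tensor product of two C*-algebras, equipped with the minimal tensor norm. -/
def AlgMinTensor : Type u := A ⊗[ℂ] B

instance : AddCommGroup (AlgMinTensor A B) := inferInstanceAs (AddCommGroup (A ⊗[ℂ] B))

instance : SeminormedAddCommGroup (AlgMinTensor A B) :=
  (minTensorSeminorm A B).toSeminormedAddCommGroup

variable (A B) in
/-- The minimal tensor product of two C*-algebras: the completion of the algebraic tensor product
in the minimal tensor norm. (Its product and involution play no role for exact sequences.) -/
abbrev MinTensor : Type u := UniformSpace.Completion (AlgMinTensor A B)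

/-- The representation `σ ∘ f`. -/
def HilbertRep.comp (σ : HilbertRep D) (f : B →⋆ₙₐ[ℂ] D) : HilbertRep B where
  space := σ.space
  rep := σ.rep.comp f

theorem HilbertRep.tensor_lTensor (π : HilbertRep A) (σ : HilbertRep D) (f : B →⋆ₙₐ[ℂ] D)
    (x : A ⊗[ℂ] B) :
    π.tensor σ (LinearMap.lTensor A (f : B →ₗ[ℂ] D) x) = π.tensor (σ.comp f) x := by
  have h : (π.tensor σ).comp (LinearMap.lTensor A (f : B →ₗ[ℂ] D)) = π.tensor (σ.comp f) :=
    TensorProduct.ext' fun _ _ => rfl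
  exact LinearMap.congr_fun h x

theorem minTensorNorm_lTensor_le (f : B →⋆ₙₐ[ℂ] D) (x : A ⊗[ℂ] B) :
    minTensorNorm (LinearMap.lTensor A (f : B →ₗ[ℂ] D) x) ≤ minTensorNorm x := by
  refine ciSup_le fun ρ => ?_
  refine (congrArg norm (HilbertRep.tensor_lTensor ρ.1 ρ.2 f x)).trans_le ?_
  exact le_ciSup (minTensorNorm_bddAbove x) (ρ.1, ρ.2.comp f)

variable (A) in
/-- The map `id ⊗ f : A ⊗ B → A ⊗ D` between algebraic tensor products with the minimal norm. -/
def AlgMinTensor.lTensor (f : B →⋆ₙₐ[ℂ] D) :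
    NormedAddGroupHom (AlgMinTensor A B) (AlgMinTensor A D) where
  toFun := LinearMap.lTensor A (f : B →ₗ[ℂ] D)
  map_add' := map_add (LinearMap.lTensor A (f : B →ₗ[ℂ] D))
  bound' := ⟨1, fun x => (minTensorNorm_lTensor_le f x).trans_eq (one_mul _).symm⟩

variable (A) in
/-- The map `id ⊗ f : A ⊗ B → A ⊗ D` between minimal tensor products induced by a *-homomorphism
`f : B → D`: the continuous extension of the algebraic map. -/
def MinTensor.lTensor (f : B →⋆ₙₐ[ℂ] D) : NormedAddGroupHom (MinTensor A B) (MinTensor A D) :=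
  (AlgMinTensor.lTensor A f).completion

end MinTensor

/-- Exactness of a C*-algebra `C`: for every short exact sequence `0 → J → B → D → 0` of
C*-algebras (that is, up to isomorphism, for every closed two-sided ideal `J` of a C*-algebra `B`,
with `D = B / J`), the sequence `0 → C ⊗ J → C ⊗ B → C ⊗ D → 0` of minimal tensor products is
exact. -/
def IsExactCStarAlgebra (C : Type u) [NonUnitalCStarAlgebra C] : Prop :=
  ∀ (J B D : Type u) [NonUnitalCStarAlgebra J] [NonUnitalCStarAlgebra B] [NonUnitalCStarAlgebra D]
    (i : J →⋆ₙₐ[ℂ] B) (q : B →⋆ₙₐ[ℂ] D),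
    Function.Injective i → Function.Exact i q → Function.Surjective q →
      Function.Injective (MinTensor.lTensor C i) ∧
      Function.Exact (MinTensor.lTensor C i) (MinTensor.lTensor C q) ∧
      Function.Surjective (MinTensor.lTensor C q)

end

/-! Everything rests on convergence in measure: `x` is small when `‖x * p‖` is small for a
projection `p` with `τ (1 - p)` small. On projections, `τ` is a faithful, completely additive
dimension function. Left and right supports have equal dimension (`IsDimension.supp_star`), so
dimension is subadditive on joins (`IsDimension.supp_pair_le`), and bounded sequences may be added,
multiplied and starred under limits in measure. Spectral projections show that the norm is lower
semicontinuous for such limits (`norm_le_of_smallInMeasure`).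

Hence the bounded sequences in `A` that converge in measure form a C*-algebra `D`, and the limit is
a *-homomorphism `D → N`. Its range contains `A` and is an AW*-subalgebra
(`isAWStarSubalgebra_measClosure`), so it contains `B`.

For `z` in the algebraic tensor product of `C` and `D`, evaluate at `n` and multiply in `N`. By (i)
the result has norm at most `‖z‖_min`, and it converges in measure to the product formed from the
limits, which therefore obeys the same bound. Multiplication thus kills the tensors over the kernel
`J` of the limit map. Exactness of `C` identifies the kernel of `C ⊗ D → C ⊗ (D / J)` with `C ⊗ J`,
so multiplication on the tensor product of `C` with the range is bounded for the minimal norm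
(`exists_bound_of_exact`). A bounded *-homomorphism is contractive by the C*-identity
(`norm_le_minTensorNorm_of_bounded`). -/

noncomputable section

open Filter Topology
open scoped BoundedContinuousFunction

/-! ### Support projections in a Baer *-ring -/

section Support

variable {N : Type*} [CStarAlgebra N]

/-- In a Baer *-ring: the projection with the same right annihilator as `S`. -/
def supp (hN : IsBaerStarRing N) (S : Set N) : N := 1 - (hN S).choose

theorem supp_proj (hN : IsBaerStarRing N) (S : Set N) : IsStarProjection (supp hN S) :=
  (hN S).choose_spec.1.one_sub

theorem supp_mul_eq_zero (hN : IsBaerStarRing N) {S : Set N} {y : N} :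
    supp hN S * y = 0 ↔ ∀ s ∈ S, s * y = 0 := by
  have h := (hN S).choose_spec
  rw [h.2 y, supp]
  constructor
  · intro h0
    refine ⟨y, ?_⟩
    rw [sub_mul, one_mul, sub_eq_zero] at h0
    exact h0
  · rintro ⟨z, rfl⟩
    rw [← mul_assoc, sub_mul, one_mul, h.1.isIdempotentElem.eq, sub_self, zero_mul]

theorem supp_singleton_mul_eq_zero (hN : IsBaerStarRing N) {x y : N} :
    supp hN {x} * y = 0 ↔ x * y = 0 := by
  simp [supp_mul_eq_zero]

theorem mul_supp (hN : IsBaerStarRing N) {S : Set N} {s : N} (hs : s ∈ S) :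
    s * supp hN S = s := by
  have h := (supp_mul_eq_zero hN).1 (supp_proj hN S).mul_one_sub_self s hs
  rw [mul_sub, mul_one, sub_eq_zero] at h
  exact h.symm

theorem IsStarProjection.star_eq {p : N} (hp : IsStarProjection p) : star p = p :=
  hp.isSelfAdjoint.star_eq

theorem IsStarProjection.mul_self {p : N} (hp : IsStarProjection p) : p * p = p :=
  hp.isIdempotentElem.eq

theorem IsStarProjection.mul_eq_left_comm {p q : N} (hp : IsStarProjection p)
    (hq : IsStarProjection q) (h : p * q = p) : q * p = p := by
  simpa [hp.star_eq, hq.star_eq] using congrArg star h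

theorem IsStarProjection.mul_eq_zero_comm {p q : N} (hp : IsStarProjection p)
    (hq : IsStarProjection q) (h : p * q = 0) : q * p = 0 := by
  simpa [hp.star_eq, hq.star_eq] using congrArg star h

/-- `supp S` is below a projection `f` iff `S` is fixed by `f`. -/
theorem supp_mul_eq (hN : IsBaerStarRing N) {S : Set N} {f : N} (h : ∀ s ∈ S, s * f = s) :
    supp hN S * f = supp hN S := by
  have : supp hN S * (1 - f) = 0 := (supp_mul_eq_zero hN).2 fun s hs => by
    rw [mul_sub, mul_one, h s hs, sub_self]
  rw [mul_sub, mul_one, sub_eq_zero] at this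
  exact this.symm

theorem isProjectionSup_supp (hN : IsBaerStarRing N) (P : Set N) :
    IsProjectionSup P (supp hN P) :=
  ⟨supp_proj hN P, fun _ hp => mul_supp hN hp, fun _ _ h => supp_mul_eq hN h⟩

theorem IsProjectionSup.eq_supp (hN : IsBaerStarRing N) {P : Set N} {e : N}
    (he : IsProjectionSup P e) : e = supp hN P := by
  have h1 := he.2.2 _ (supp_proj hN P) fun p hp => mul_supp hN hp
  rw [← h1]
  exact (supp_proj hN P).mul_eq_left_comm he.1 (supp_mul_eq hN he.2.1)

theorem IsStarProjection.eq_of_le_of_le {p q : N} (hp : IsStarProjection p)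
    (hq : IsStarProjection q) (h1 : p * q = p) (h2 : q * p = q) : p = q := by
  rw [← h1, hq.mul_eq_left_comm hp h2]

/-- Elements commuting with a self-adjoint element commute with its support. -/
theorem commute_supp (hN : IsBaerStarRing N) {g k : N} (hk : IsSelfAdjoint k)
    (h : Commute g k) : Commute (supp hN {g}) k := by
  set e := supp hN {g} with he
  have hp : IsStarProjection e := supp_proj hN _
  have h1 : e * (k * (1 - e)) = 0 := by
    have h0 : g * (1 - e) = 0 := (supp_singleton_mul_eq_zero hN).1 (he ▸ hp.mul_one_sub_self)
    rw [he, supp_singleton_mul_eq_zero, ← mul_assoc, h.eq, mul_assoc, ← he, h0, mul_zero]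
  have h2 : e * k = e * k * e := by
    rw [mul_sub, mul_one, mul_sub, sub_eq_zero] at h1
    rw [mul_assoc, ← h1]
  have h3 : k * e = e * k * e := by
    have := congrArg star h2
    simpa [hp.star_eq, hk.star_eq, mul_assoc] using this
  rw [commute_iff_eq, h2, h3]

/-- The join of two projections. -/
theorem supp_pair_sub (hN : IsBaerStarRing N) {p q : N} (hq : IsStarProjection q) :
    supp hN {p * (1 - q)} = supp hN {p, q} - q := by
  set e := supp hN {p, q} with he
  have hep : IsStarProjection e := supp_proj hN _
  have hqe : q * e = q := mul_supp hN (by simp)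
  have heq : e * q = q := hq.mul_eq_left_comm hep hqe
  have hsub : IsStarProjection (e - q) := hq.sub_of_mul_eq_left hep hqe
  have h1 : (e - q) = e * (1 - q) := by rw [mul_sub, mul_one, heq]
  refine IsStarProjection.eq_of_le_of_le (supp_proj hN _) hsub (supp_mul_eq hN ?_) ?_
  · rintro _ rfl
    have hpe : p * e = p := mul_supp hN (by simp)
    have h3 : (1 - q) * (e - q) = e - q := by
      rw [sub_mul, one_mul, mul_sub, hqe, hq.mul_self, sub_self, sub_zero]
    rw [mul_assoc, h3, mul_sub, mul_sub, mul_one, hpe]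
  · set S := supp hN {p * (1 - q)}
    have h3 : p * (1 - q) * (1 - S) = 0 :=
      (supp_singleton_mul_eq_zero hN).1 (supp_proj hN _).mul_one_sub_self
    -- Both `p` and `q` kill `(1 - q) * (1 - S)` from the left, hence so does their join.
    have h4 : e * ((1 - q) * (1 - S)) = 0 := by
      rw [he, supp_mul_eq_zero]
      rintro s (rfl | rfl)
      · rw [← mul_assoc, h3]
      · rw [← mul_assoc, hq.mul_one_sub_self, zero_mul]
    rw [← mul_assoc, ← h1, mul_sub, mul_one, sub_eq_zero] at h4
    exact h4.symm

/-! ### Spectral projections and truncated polar decomposition -/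

/-- The spectral projection of `h` for the interval `(t, ∞)`. -/
def specProj (hN : IsBaerStarRing N) (h : N) (t : ℝ) : N :=
  supp hN {cfc (fun s : ℝ => max (s - t) 0) h}

theorem specProj_proj (hN : IsBaerStarRing N) (h : N) (t : ℝ) :
    IsStarProjection (specProj hN h t) := supp_proj hN _

theorem specProj_commute (hN : IsBaerStarRing N) (h : N) (t : ℝ) (f : ℝ → ℝ) :
    Commute (specProj hN h t) (cfc f h) :=
  commute_supp hN (cfc_predicate f h) (cfc_commute_cfc _ _ h)

/-- The functions `f` and `(s - t)₊` have product zero, and the support of `(h - t)₊` has the same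
right annihilator as `(h - t)₊`. -/
theorem cfc_mul_specProj_eq_zero (hN : IsBaerStarRing N) (h : N) {t : ℝ}
    {f : ℝ → ℝ} (hf : Continuous f) (h0 : ∀ s, t ≤ s → f s = 0) :
    cfc f h * specProj hN h t = 0 := by
  rw [← (specProj_commute hN h t f).eq, specProj, supp_singleton_mul_eq_zero,
    ← cfc_mul _ f h (by fun_prop) hf.continuousOn]
  rw [← cfc_zero (R := ℝ) (p := IsSelfAdjoint) h]
  refine cfc_congr fun s _ => ?_
  rcases le_total t s with hs | hs
  · simp [h0 s hs]
  · simp [max_eq_right (sub_nonpos.2 hs)]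

theorem cfc_mul_specProj_congr (hN : IsBaerStarRing N) (h : N) {t : ℝ}
    {f g : ℝ → ℝ} (hf : Continuous f) (hg : Continuous g) (h0 : ∀ s, t ≤ s → f s = g s) :
    cfc f h * specProj hN h t = cfc g h * specProj hN h t := by
  rw [← sub_eq_zero, ← sub_mul, ← cfc_sub f g h hf.continuousOn hg.continuousOn]
  exact cfc_mul_specProj_eq_zero hN h (hf.sub hg) fun s hs => sub_eq_zero.2 (h0 s hs)

theorem specProj_mul_of_le (hN : IsBaerStarRing N) (h : N) {t t' : ℝ} (htt : t ≤ t') :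
    specProj hN h t' * specProj hN h t = specProj hN h t' := by
  rcases htt.eq_or_lt with rfl | hlt
  · exact (specProj_proj hN h t).mul_self
  have hδ : 0 < t' - t := sub_pos.2 hlt
  refine supp_mul_eq hN ?_
  rintro _ rfl
  -- The quotient of `(s - t')₊` by `(s - t)₊`, with the denominator kept at least `t' - t`; this
  -- changes it only where the numerator vanishes.
  have hc : Continuous fun s : ℝ => max (s - t') 0 / max (s - t) (t' - t) :=
    Continuous.div (by fun_prop) (by fun_prop) fun s => (hδ.trans_le (le_max_right _ _)).ne'
  have hfac : cfc (fun s : ℝ => max (s - t') 0) h =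
      cfc (fun s : ℝ => max (s - t') 0 / max (s - t) (t' - t)) h *
        cfc (fun s : ℝ => max (s - t) 0) h := by
    rw [← cfc_mul _ _ h hc.continuousOn (by fun_prop)]
    refine cfc_congr fun s _ => ?_
    rcases le_or_gt s t' with hs | hs
    · simp [max_eq_right (sub_nonpos.2 hs)]
    · have h1 : t' - t ≤ s - t := by linarith
      have h2 : 0 < s - t := by linarith
      simp only [max_eq_left h1, max_eq_left h2.le]
      field_simp
  rw [hfac, mul_assoc, specProj, mul_supp hN (Set.mem_singleton _)]

/-- The thresholds `1 / (n + 1)`. -/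
def thr (n : ℕ) : ℝ := 1 / ((n : ℝ) + 1)

theorem thr_pos (n : ℕ) : 0 < thr n := Nat.one_div_pos_of_nat

theorem thr_anti {m n : ℕ} (h : m ≤ n) : thr n ≤ thr m := Nat.one_div_le_one_div h

theorem tendsto_thr : Tendsto thr atTop (𝓝 0) := tendsto_one_div_add_atTop_nhds_zero_nat

/-- On a nonnegative spectrum, `h` and its truncation `(h - t)₊` differ by at most `t` in norm, and
every truncation kills `y`. -/
theorem mul_eq_zero_of_specProj (hN : IsBaerStarRing N) {h : N} (hsa : IsSelfAdjoint h)
    (hpos : ∀ s ∈ spectrum ℝ h, 0 ≤ s) {y : N} (hy : ∀ n, specProj hN h (thr n) * y = 0) :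
    h * y = 0 := by
  have key : ∀ n, ‖h * y‖ ≤ thr n * ‖y‖ := by
    intro n
    have h1 : cfc (fun s : ℝ => max (s - thr n) 0) h * y = 0 :=
      (supp_singleton_mul_eq_zero hN).1 (hy n)
    have h2 : h * y = cfc (fun s : ℝ => s - max (s - thr n) 0) h * y := by
      rw [cfc_sub _ _ h (by fun_prop) (by fun_prop), sub_mul, h1, sub_zero, cfc_id' ℝ h]
    rw [h2]
    refine (norm_mul_le _ _).trans (mul_le_mul_of_nonneg_right ?_ (norm_nonneg _))
    refine norm_cfc_le (thr_pos n).le fun s hs => ?_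
    have := hpos s hs
    have := thr_pos n
    rw [Real.norm_eq_abs, abs_le]
    rcases le_total (s - thr n) 0 with h | h
    · rw [max_eq_right h]; constructor <;> linarith
    · rw [max_eq_left h]; constructor <;> linarith
  have lim : Tendsto (fun n => thr n * ‖y‖) atTop (𝓝 (0 * ‖y‖)) := tendsto_thr.mul_const _
  rw [zero_mul] at lim
  exact norm_le_zero_iff.1 (ge_of_tendsto' lim key)

/-- A continuous function that inverts the square root on `[t, ∞)`. -/
def invSqrt (t s : ℝ) : ℝ := 1 / √(max s t)

theorem continuous_invSqrt {t : ℝ} (ht : 0 < t) : Continuous (invSqrt t) :=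
  Continuous.div (by fun_prop) (by fun_prop) fun s =>
    (Real.sqrt_pos.2 (ht.trans_le (le_max_right _ _))).ne'

/-- The partial isometry in the polar decomposition of `x`, cut off where `x⋆x ≤ t`. -/
def polarCut (hN : IsBaerStarRing N) (x : N) (t : ℝ) : N :=
  x * cfc (invSqrt t) (star x * x) * specProj hN (star x * x) t

theorem star_polarCut_mul (hN : IsBaerStarRing N) (x : N) {t : ℝ} (ht : 0 < t) :
    star (polarCut hN x t) * polarCut hN x t = specProj hN (star x * x) t := by
  set h := star x * x with hh
  have hsa : IsSelfAdjoint h := IsSelfAdjoint.star_mul_self x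
  set e := specProj hN h t with he
  have hp : IsStarProjection e := specProj_proj hN h t
  have hc := continuous_invSqrt ht
  have hd : star (cfc (invSqrt t) h) = cfc (invSqrt t) h :=
    (cfc_predicate (R := ℝ) (p := IsSelfAdjoint) (invSqrt t) h).star_eq
  have h3 : cfc (invSqrt t) h * h * cfc (invSqrt t) h * e = e := by
    have h1 : cfc (invSqrt t) h * h * cfc (invSqrt t) h =
        cfc (fun s => invSqrt t s * s * invSqrt t s) h := by
      rw [cfc_mul (fun s => invSqrt t s * s) _ h (by fun_prop) (by fun_prop),
        cfc_mul (invSqrt t) (fun s => s) h (by fun_prop) (by fun_prop), cfc_id' ℝ h]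
    rw [h1, cfc_mul_specProj_congr hN h (g := fun _ => 1) (by fun_prop) (by fun_prop),
      cfc_const_one ℝ h, one_mul]
    intro s hs
    have hs0 : 0 < s := ht.trans_le hs
    rw [invSqrt, max_eq_left hs]
    have := Real.mul_self_sqrt hs0.le
    have h2 : √s ≠ 0 := (Real.sqrt_pos.2 hs0).ne'
    field_simp
    nlinarith
  calc star (polarCut hN x t) * polarCut hN x t
      = e * (cfc (invSqrt t) h * h * cfc (invSqrt t) h * e) := by
        simp only [polarCut, ← hh, ← he, star_mul, hd, hp.star_eq]
        simp only [hh, mul_assoc]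
    _ = e := by rw [h3, hp.mul_self]

/-- Above the larger threshold both cut-off inverse square roots agree, so the truncated partial
isometries extend one another as the threshold decreases. -/
theorem polarCut_mul_of_le (hN : IsBaerStarRing N) (x : N) {t t' : ℝ} (ht : 0 < t)
    (htt : t ≤ t') :
    polarCut hN x t * specProj hN (star x * x) t' = polarCut hN x t' := by
  set h := star x * x with hh
  rw [polarCut, polarCut, ← hh, mul_assoc,
    (specProj_proj hN h t').mul_eq_left_comm (specProj_proj hN h t)
      (specProj_mul_of_le hN h htt), mul_assoc, mul_assoc,
    cfc_mul_specProj_congr hN h (continuous_invSqrt ht) (continuous_invSqrt (ht.trans_le htt))]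
  intro s hs
  rw [invSqrt, invSqrt, max_eq_left hs, max_eq_left (htt.trans hs)]

/-- The factor `invSqrt t` of `star x * x` is invertible and commutes with the spectral projection,
so it can be cancelled. -/
theorem mul_specProj_eq_zero_of_polarCut (hN : IsBaerStarRing N) {x z : N} {t : ℝ} (ht : 0 < t)
    (h0 : z * polarCut hN x t = 0) : z * x * specProj hN (star x * x) t = 0 := by
  set h := star x * x with hh
  set e := specProj hN h t with he
  have hc := continuous_invSqrt ht
  have hpos : ∀ s, 0 < √(max s t) := fun s => Real.sqrt_pos.2 (ht.trans_le (le_max_right _ _))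
  have h1 : cfc (invSqrt t) h * cfc (fun s => √(max s t)) h = 1 := by
    rw [← cfc_mul _ _ h hc.continuousOn (by fun_prop), ← cfc_const_one ℝ h]
    refine cfc_congr fun s _ => ?_
    have := (hpos s).ne'
    simp only [invSqrt]
    field_simp
  calc z * x * e = z * x * (cfc (invSqrt t) h * cfc (fun s => √(max s t)) h) * e := by
        rw [h1, mul_one]
    _ = z * x * (cfc (invSqrt t) h * (cfc (fun s => √(max s t)) h * e)) := by
        simp only [mul_assoc]
    _ = z * (x * cfc (invSqrt t) h * e) * cfc (fun s => √(max s t)) h := by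
        rw [← (specProj_commute hN h t _).eq]; simp only [mul_assoc, he]
    _ = 0 := by rw [← zero_mul, ← h0, polarCut]

end Support

/-! ### Dimension functions on projections -/

/-- A completely additive faithful dimension function on the projections of a *-ring. -/
structure IsDimension {N : Type*} [CStarAlgebra N] (δ : N → ℝ) : Prop where
  nonneg : ∀ p, IsStarProjection p → 0 ≤ δ p
  faithful : ∀ p, IsStarProjection p → δ p = 0 → p = 0
  equiv : ∀ u, δ (star u * u) = δ (u * star u)
  hasSum : ∀ P : Set N, IsOrthogonalProjectionSet P → ∀ e : N, IsProjectionSup P e →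
    HasSum (fun p : P => δ p) (δ e)

/-- Since `p = star p * p`, positivity makes `τ p` real, so passing to the real part loses nothing
on projections. -/
theorem IsQuasitrace.isDimension {N : Type*} [CStarAlgebra N] {τ : N → ℂ} (hτ : IsQuasitrace τ)
    (hτf : IsFaithfulQuasitrace τ) (hτn : IsNormalQuasitrace τ) :
    IsDimension fun x => (τ x).re where
  nonneg p hp := by
    have := hτ.1.star_mul_self_nonneg p
    rw [hp.star_eq, hp.mul_self] at this
    exact (Complex.le_def.1 this).1
  faithful p hp h := by
    refine hτf p ?_
    have := hτ.1.star_mul_self_nonneg p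
    rw [hp.star_eq, hp.mul_self] at this ⊢
    exact Complex.ext h (Complex.le_def.1 this).2.symm
  equiv u := by rw [hτ.1.star_mul_self u]
  hasSum P hP e he := by
    simpa [Function.comp_def] using Complex.reCLM.hasSum (hτn P hP e he)

namespace IsDimension

variable {N : Type*} [CStarAlgebra N] {δ : N → ℝ}

theorem map_zero (hδ : IsDimension δ) : δ 0 = 0 := by
  have h := hδ.hasSum ∅ ⟨by simp, by simp⟩ 0 ⟨.zero N, by simp, by simp⟩
  exact h.unique hasSum_empty

/-- An orthogonal sequence can repeat only the value `0`, and `δ 0 = 0`, so summing over indices or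
over the range is the same. -/
theorem hasSum_nat (hδ : IsDimension δ) {p : ℕ → N} (hp : ∀ n, IsStarProjection (p n))
    (horth : ∀ m n, m ≠ n → p m * p n = 0) {e : N} (he : IsProjectionSup (Set.range p) e) :
    HasSum (fun n => δ (p n)) (δ e) := by
  have hinj : ∀ m n, p m ≠ 0 → p m = p n → m = n := by
    intro m n h0 hmn
    by_contra hne
    have := horth m n hne
    rw [← hmn, (hp m).mul_self] at this
    exact h0 this
  have h1 := hδ.hasSum (Set.range p) ⟨by rintro _ ⟨n, rfl⟩; exact hp n, by
    rintro _ ⟨m, rfl⟩ _ ⟨n, rfl⟩ hmn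
    exact horth m n fun h => hmn (by rw [h])⟩ e he
  refine (hasSum_iff_hasSum_of_ne_zero_bij (f := fun q : Set.range p => δ q)
    (fun n : Function.support fun n => δ (p n) => ⟨p n, n, rfl⟩) ?_ ?_ fun _ => rfl).1 h1
  · intro m n hmn
    refine Subtype.ext (hinj _ _ (fun h0 => m.2 ?_) (congrArg Subtype.val hmn))
    change δ (p m) = 0
    rw [h0, hδ.map_zero]
  · rintro ⟨_, n, rfl⟩ hn
    exact ⟨⟨n, hn⟩, rfl⟩

theorem add_of_orthogonal (hδ : IsDimension δ) {p q : N} (hp : IsStarProjection p)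
    (hq : IsStarProjection q) (h : p * q = 0) : δ (p + q) = δ p + δ q := by
  have h' := hp.mul_eq_zero_comm hq h
  let r : ℕ → N := fun n => if n = 0 then p else if n = 1 then q else 0
  have hr : ∀ n, IsStarProjection (r n) := fun n => by
    simp only [r]; split_ifs; exacts [hp, hq, .zero N]
  have key := hδ.hasSum_nat (p := r) (e := p + q) hr (fun m n hmn => by
    simp only [r]; split_ifs <;> first | omega | exact h | exact h' | exact mul_zero _ | exact zero_mul _) ⟨hp.add hq h, ?_, ?_⟩
  · have h2 : HasSum (fun n => δ (r n)) (∑ n ∈ Finset.range 2, δ (r n)) :=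
      hasSum_sum_of_ne_finset_zero fun n hn => by
        simp only [Finset.mem_range, not_lt] at hn
        simp [r, show n ≠ 0 by omega, show n ≠ 1 by omega, hδ.map_zero]
    rw [key.unique h2]
    simp [Finset.sum_range_succ, r]
  · rintro _ ⟨n, rfl⟩
    simp only [r]; split_ifs <;> simp [mul_add, h, h', hp.mul_self, hq.mul_self]
  · intro f _ hf
    have h0 := hf _ ⟨0, rfl⟩
    have h1 := hf _ ⟨1, rfl⟩
    simp only [r] at h0 h1
    simp only [if_true, one_ne_zero, if_false] at h0 h1
    rw [add_mul, h0, h1]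

theorem map_sub (hδ : IsDimension δ) {p q : N} (hp : IsStarProjection p)
    (hq : IsStarProjection q) (h : p * q = p) : δ (q - p) = δ q - δ p := by
  have h' := hp.mul_eq_left_comm hq h
  have := hδ.add_of_orthogonal (hp.sub_of_mul_eq_left hq h) hp
    (by rw [sub_mul, h', hp.mul_self, sub_self])
  rw [sub_add_cancel] at this
  linarith

theorem mono (hδ : IsDimension δ) {p q : N} (hp : IsStarProjection p)
    (hq : IsStarProjection q) (h : p * q = p) : δ p ≤ δ q := by
  have := hδ.nonneg _ (hp.sub_of_mul_eq_left hq h)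
  rw [hδ.map_sub hp hq h] at this
  linarith

/-- The differences `e 0, e 1 - e 0, …` are orthogonal with the same supremum, and their dimensions
telescope. -/
theorem tendsto_of_monotone (hδ : IsDimension δ) {e : ℕ → N} (he : ∀ n, IsStarProjection (e n))
    (hmono : ∀ m n, m ≤ n → e m * e n = e m) {E : N}
    (hE : IsProjectionSup (Set.range e) E) :
    Tendsto (fun n => δ (e n)) atTop (𝓝 (δ E)) := by
  have hmono' : ∀ m n, m ≤ n → e n * e m = e m := fun m n h =>
    (he m).mul_eq_left_comm (he n) (hmono m n h)
  let d : ℕ → N := fun n => Nat.casesOn n (e 0) fun n => e (n + 1) - e n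
  have hd : ∀ n, IsStarProjection (d n) := by
    rintro (_ | n)
    · exact he 0
    · exact (he n).sub_of_mul_eq_left (he (n + 1)) (hmono _ _ n.le_succ)
  have hsum : ∀ n, ∑ i ∈ Finset.range (n + 1), d i = e n := by
    intro n
    induction n with
    | zero => simp [d]
    | succ n ih => rw [Finset.sum_range_succ, ih]; simp [d]
  have hδsum : ∀ n, ∑ i ∈ Finset.range (n + 1), δ (d i) = δ (e n) := by
    intro n
    induction n with
    | zero => simp [d]
    | succ n ih =>
      rw [Finset.sum_range_succ, ih]
      change _ + δ (e (n + 1) - e n) = _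
      rw [hδ.map_sub (he n) (he (n + 1)) (hmono _ _ n.le_succ)]
      ring
  have hlt : ∀ m n, m < n → d m * d n = 0 := by
    intro m n hmn
    obtain ⟨n, rfl⟩ : ∃ k, n = k + 1 := ⟨n - 1, by omega⟩
    have hm : d m * e n = d m ∧ d m * e (n + 1) = d m := by
      rcases m with _ | m
      · exact ⟨hmono _ _ (by omega), hmono _ _ (by omega)⟩
      · change (e (m + 1) - e m) * _ = _ ∧ (e (m + 1) - e m) * _ = _
        rw [sub_mul, sub_mul, hmono _ _ (by omega), hmono _ _ (by omega), hmono _ _ (by omega),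
          hmono _ _ (by omega)]
        exact ⟨rfl, rfl⟩
    change d m * (e (n + 1) - e n) = 0
    rw [mul_sub, hm.1, hm.2, sub_self]
  have key := hδ.hasSum_nat hd (fun m n hmn => by
    rcases lt_or_gt_of_ne hmn with h | h
    · exact hlt _ _ h
    · exact (hd n).mul_eq_zero_comm (hd m) (hlt _ _ h)) (e := E) ⟨hE.1, ?_, ?_⟩
  · have := (tendsto_add_atTop_iff_nat 1).2 key.tendsto_sum_nat
    simpa only [hδsum] using this
  · rintro _ ⟨n, rfl⟩
    have hle : ∀ n, e n * E = e n := fun n => hE.2.1 _ ⟨n, rfl⟩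
    rcases n with _ | n
    · exact hle 0
    · change (e (n + 1) - e n) * E = e (n + 1) - e n
      rw [sub_mul, hle, hle]
  · intro f hf h
    refine hE.2.2 f hf ?_
    rintro _ ⟨n, rfl⟩
    rw [← hsum n, Finset.sum_mul]
    exact Finset.sum_congr rfl fun i _ => h _ ⟨i, rfl⟩

theorem isProjectionSup_specProj (hN : IsBaerStarRing N) (x : N) :
    IsProjectionSup (Set.range fun n => specProj hN (star x * x) (thr n)) (supp hN {x}) := by
  have hsa := IsSelfAdjoint.star_mul_self x
  have hsupp : ∀ f, x * (1 - f) = 0 → supp hN {x} * f = supp hN {x} := fun f hf =>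
    supp_mul_eq hN fun s hs => by
      rw [Set.mem_singleton_iff.1 hs]
      rw [mul_sub, mul_one, sub_eq_zero] at hf
      exact hf.symm
  refine ⟨supp_proj hN _, ?_, ?_⟩
  · rintro _ ⟨n, rfl⟩
    refine supp_mul_eq hN ?_
    rintro _ rfl
    have h0 : star x * x * (1 - supp hN {x}) = 0 := by
      rw [mul_assoc, (supp_singleton_mul_eq_zero hN).1 (supp_proj hN _).mul_one_sub_self, mul_zero]
    -- The truncation is a continuous multiple of `star x * x`, hence fixed on the right by the
    -- support of `x`.
    have h1 : cfc (fun s : ℝ => max (s - thr n) 0) (star x * x) =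
        cfc (fun s : ℝ => max (s - thr n) 0 / max s (thr n)) (star x * x) * (star x * x) := by
      have hc : Continuous fun s : ℝ => max (s - thr n) 0 / max s (thr n) :=
        Continuous.div (by fun_prop) (by fun_prop) fun s =>
          ((thr_pos n).trans_le (le_max_right _ _)).ne'
      have h2 := cfc_mul _ (fun s => s) (star x * x) hc.continuousOn (by fun_prop)
      rw [cfc_id' ℝ (star x * x)] at h2
      rw [← h2]
      refine cfc_congr fun s _ => ?_
      rcases le_total s (thr n) with hs | hs
      · simp [max_eq_right (sub_nonpos.2 hs)]
      · have := (thr_pos n).trans_le hs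
        simp only [max_eq_left hs]
        field_simp
    rw [mul_sub, mul_one, sub_eq_zero] at h0
    rw [h1, mul_assoc, ← h0]
  · intro f hf h
    refine hsupp f ?_
    have h2 : star x * x * (1 - f) = 0 :=
      mul_eq_zero_of_specProj hN hsa spectrum_star_mul_self_nonneg fun n => by
        rw [mul_sub, mul_one, h _ ⟨n, rfl⟩, sub_self]
    rw [← CStarRing.star_mul_self_eq_zero_iff, star_mul, mul_assoc, ← mul_assoc (star x), h2,
      mul_zero]

/-- This replaces a full polar decomposition. The truncated partial isometries `w n` have initial
projections increasing to the support of `x` and final projections increasing to that of `star x`.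
These have equal dimension for each `n`, and complete additivity passes to the limit. -/
theorem supp_star (hδ : IsDimension δ) (hN : IsBaerStarRing N) (x : N) :
    δ (supp hN {star x}) = δ (supp hN {x}) := by
  set h := star x * x with hh
  set e : ℕ → N := fun n => specProj hN h (thr n) with he
  set w : ℕ → N := fun n => polarCut hN x (thr n) with hw
  have hep : ∀ n, IsStarProjection (e n) := fun n => specProj_proj hN _ _
  have hee : ∀ m n, m ≤ n → e m * e n = e m := fun m n hmn =>
    specProj_mul_of_le hN h (thr_anti hmn)
  have hww : ∀ n, star (w n) * w n = e n := fun n => star_polarCut_mul hN x (thr_pos n)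
  have hwe : ∀ m n, m ≤ n → w n * e m = w m := fun m n hmn =>
    polarCut_mul_of_le hN x (thr_pos n) (thr_anti hmn)
  have hfw : ∀ n, w n * star (w n) * w n = w n := fun n => by
    rw [mul_assoc, hww, hwe n n le_rfl]
  have hfp : ∀ n, IsStarProjection (w n * star (w n)) := fun n =>
    ⟨by rw [IsIdempotentElem, ← mul_assoc, hfw], IsSelfAdjoint.mul_star_self _⟩
  have hff : ∀ m n, m ≤ n → w m * star (w m) * (w n * star (w n)) = w m * star (w m) := by
    intro m n hmn
    have h1 : w n * star (w n) * (w m * star (w m)) = w m * star (w m) := by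
      rw [← hwe m n hmn, ← mul_assoc, ← mul_assoc, hfw]
    simpa only [star_mul, star_star, mul_assoc] using congrArg star h1
  have hsup : IsProjectionSup (Set.range fun n => w n * star (w n)) (supp hN {star x}) := by
    refine ⟨supp_proj hN _, ?_, ?_⟩
    · rintro _ ⟨n, rfl⟩
      have : star (w n) * supp hN {star x} = star (w n) := by
        simp only [hw, polarCut, star_mul, mul_assoc, mul_supp hN (Set.mem_singleton (star x))]
      rw [mul_assoc, this]
    · intro f hf h1
      refine supp_mul_eq hN ?_
      rintro _ rfl
      have h2 : ∀ n, (1 - f) * w n = 0 := fun n => by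
        have h3 := (hfp n).mul_eq_left_comm hf (h1 _ ⟨n, rfl⟩)
        rw [sub_mul, one_mul, sub_eq_zero, ← hfw n, ← mul_assoc, h3]
      have h4 : ∀ n, e n * star ((1 - f) * x) = 0 := fun n => by
        have := mul_specProj_eq_zero_of_polarCut hN (thr_pos n) (h2 n)
        have := congrArg star this
        rwa [star_mul, (specProj_proj hN _ _).star_eq, star_zero] at this
      have h5 := mul_eq_zero_of_specProj hN (IsSelfAdjoint.star_mul_self x)
        spectrum_star_mul_self_nonneg h4
      have h6 : star x * (1 - f) = 0 := by
        have h7 : x * star ((1 - f) * x) = 0 := by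
          rw [← CStarRing.star_mul_self_eq_zero_iff, star_mul, mul_assoc, ← mul_assoc (star x), h5,
            mul_zero]
        rw [star_mul, ← mul_assoc, hf.one_sub.star_eq] at h7
        rw [← CStarRing.star_mul_self_eq_zero_iff, star_mul, star_star, hf.one_sub.star_eq,
          mul_assoc, ← mul_assoc x, h7, mul_zero]
      rw [mul_sub, mul_one, sub_eq_zero] at h6
      exact h6.symm
  have l1 := hδ.tendsto_of_monotone hep hee (isProjectionSup_specProj hN x)
  have l2 := hδ.tendsto_of_monotone hfp hff hsup
  refine tendsto_nhds_unique l2 (l1.congr fun n => ?_)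
  rw [← hδ.equiv, hww]

theorem supp_le_of_mul (hδ : IsDimension δ) (hN : IsBaerStarRing N) {p x : N}
    (hp : IsStarProjection p) (h : p * x = x) : δ (supp hN {x}) ≤ δ p := by
  rw [← hδ.supp_star hN]
  refine hδ.mono (supp_proj hN _) hp (supp_mul_eq hN ?_)
  rintro _ rfl
  have := congrArg star h
  rwa [star_mul, hp.star_eq] at this

/-- The parallelogram law: the join minus `q` is the right support of `p * (1 - q)`, whose left
support lies under `p`. -/
theorem supp_pair_le (hδ : IsDimension δ) (hN : IsBaerStarRing N) {p q : N}
    (hp : IsStarProjection p) (hq : IsStarProjection q) :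
    δ (supp hN {p, q}) ≤ δ p + δ q := by
  have h3 := hδ.map_sub hq (supp_proj hN _) (mul_supp hN (S := {p, q}) (by simp))
  have h4 := hδ.supp_le_of_mul hN (x := p * (1 - q)) hp (by rw [← mul_assoc, hp.mul_self])
  rw [supp_pair_sub hN hq] at h4
  linarith

end IsDimension

/-! ### Convergence in measure -/

section Measure

variable {N : Type*} [CStarAlgebra N] {δ : N → ℝ}

theorem IsStarProjection.norm_le_one {p : N} (hp : IsStarProjection p) : ‖p‖ ≤ 1 :=
  IsStarProjection.norm_le p hp

theorem IsStarProjection.norm_eq_one {p : N} (hp : IsStarProjection p) (h0 : p ≠ 0) : ‖p‖ = 1 := by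
  have h := CStarRing.norm_star_mul_self (x := p)
  rw [hp.star_eq, hp.mul_self] at h
  have := norm_pos_iff.2 h0
  nlinarith

theorem IsDimension.one_sub (hδ : IsDimension δ) {p : N} (hp : IsStarProjection p) :
    δ (1 - p) = δ 1 - δ p :=
  hδ.map_sub hp (.one N) (mul_one p)

/-- Meets of projections in the projection lattice. -/
theorem IsDimension.exists_meet (hδ : IsDimension δ) (hN : IsBaerStarRing N) {p q : N}
    (hp : IsStarProjection p) (hq : IsStarProjection q) :
    ∃ r, IsStarProjection r ∧ p * r = r ∧ q * r = r ∧ δ (1 - r) ≤ δ (1 - p) + δ (1 - q) := by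
  have h := (supp_mul_eq_zero hN (S := {1 - p, 1 - q})).1 (supp_proj hN _).mul_one_sub_self
  refine ⟨1 - supp hN {1 - p, 1 - q}, (supp_proj hN _).one_sub, ?_, ?_, ?_⟩
  · have := h (1 - p) (by simp)
    rw [sub_mul 1 p, one_mul, sub_eq_zero] at this
    exact this.symm
  · have := h (1 - q) (by simp)
    rw [sub_mul 1 q, one_mul, sub_eq_zero] at this
    exact this.symm
  · rw [sub_sub_cancel]
    exact hδ.supp_pair_le hN hp.one_sub hq.one_sub

/-- `x` is `ε`-small in measure. -/
def SmallInMeasure (δ : N → ℝ) (ε : ℝ) (x : N) : Prop :=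
  ∃ p, IsStarProjection p ∧ δ (1 - p) ≤ ε ∧ ‖x * p‖ ≤ ε

namespace SmallInMeasure

variable {ε ε' : ℝ} {x y : N}

theorem mono (h : SmallInMeasure δ ε x) (hle : ε ≤ ε') : SmallInMeasure δ ε' x := by
  obtain ⟨p, hp, h1, h2⟩ := h
  exact ⟨p, hp, h1.trans hle, h2.trans hle⟩

theorem of_norm_le (hδ : IsDimension δ) (h : ‖x‖ ≤ ε) : SmallInMeasure δ ε x :=
  ⟨1, .one N, by rw [sub_self, hδ.map_zero]; exact (norm_nonneg _).trans h, by rwa [mul_one]⟩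

theorem neg (h : SmallInMeasure δ ε x) : SmallInMeasure δ ε (-x) := by
  obtain ⟨p, hp, h1, h2⟩ := h
  exact ⟨p, hp, h1, by rwa [neg_mul, norm_neg]⟩

theorem norm_mul_le_of_mul_eq {p r : N} (hr : IsStarProjection r) (hpr : p * r = r) :
    ‖x * r‖ ≤ ‖x * p‖ := by
  rw [← hpr, ← mul_assoc]
  exact (norm_mul_le _ _).trans
    (mul_le_of_le_one_right (norm_nonneg _) hr.norm_le_one)

/-- The meet of the two witnessing projections serves for the sum; subadditivity of dimension bounds
its complement. -/
theorem add (hδ : IsDimension δ) (hN : IsBaerStarRing N) (hx : SmallInMeasure δ ε x)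
    (hy : SmallInMeasure δ ε' y) : SmallInMeasure δ (ε + ε') (x + y) := by
  obtain ⟨p, hp, h1, h2⟩ := hx
  obtain ⟨q, hq, h3, h4⟩ := hy
  obtain ⟨r, hr, hpr, hqr, hle⟩ := hδ.exists_meet hN hp hq
  refine ⟨r, hr, hle.trans (add_le_add h1 h3), ?_⟩
  rw [add_mul]
  exact (norm_add_le _ _).trans (add_le_add ((norm_mul_le_of_mul_eq hr hpr).trans h2)
    ((norm_mul_le_of_mul_eq hr hqr).trans h4))

theorem mul_left {M : ℝ} (hM : 1 ≤ M) (hy : ‖y‖ ≤ M) (hx : SmallInMeasure δ ε x) :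
    SmallInMeasure δ (M * ε) (y * x) := by
  obtain ⟨p, hp, h1, h2⟩ := hx
  have hε : 0 ≤ ε := (norm_nonneg _).trans h2
  refine ⟨p, hp, h1.trans (le_mul_of_one_le_left hε hM), ?_⟩
  rw [mul_assoc]
  exact (norm_mul_le _ _).trans (mul_le_mul hy h2 (norm_nonneg _) (zero_le_one.trans hM))

theorem star (hδ : IsDimension δ) (hN : IsBaerStarRing N) (hx : SmallInMeasure δ ε x) :
    SmallInMeasure δ ε (star x) := by
  obtain ⟨p, hp, h1, h2⟩ := hx
  -- This support has dimension at most `δ (1 - p)`, and on its complement `star x` agrees with `p *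
  -- star x = star (x * p)`, which is small.
  set s := supp hN {(1 - p) * Star.star x} with hs
  have hsp : IsStarProjection s := supp_proj hN _
  refine ⟨1 - s, hsp.one_sub, ?_, ?_⟩
  · rw [sub_sub_cancel]
    refine (hδ.supp_le_of_mul hN hp.one_sub ?_).trans h1
    rw [← mul_assoc, hp.one_sub.mul_self]
  · have h0 : (1 - p) * Star.star x * (1 - s) = 0 :=
      (supp_singleton_mul_eq_zero hN).1 (hs ▸ hsp.mul_one_sub_self)
    have h3 : Star.star x * (1 - s) = p * Star.star x * (1 - s) := by
      rwa [sub_mul, sub_mul, one_mul, sub_eq_zero] at h0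
    rw [h3]
    refine (norm_mul_le _ _).trans ((mul_le_of_le_one_right (norm_nonneg _)
      hsp.one_sub.norm_le_one).trans ?_)
    rw [← norm_star, star_mul, star_star, hp.star_eq]
    exact h2

theorem mul_right (hδ : IsDimension δ) (hN : IsBaerStarRing N) {M : ℝ} (hM : 1 ≤ M) (hy : ‖y‖ ≤ M)
    (hx : SmallInMeasure δ ε x) : SmallInMeasure δ (M * ε) (x * y) := by
  have := ((hx.star hδ hN).mul_left hM ((norm_star y).trans_le hy)).star hδ hN
  rwa [star_mul, star_star, star_star] at this

end SmallInMeasure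

/-- Lower semicontinuity of the norm for convergence in measure. -/
theorem norm_le_of_smallInMeasure (hδ : IsDimension δ) (hN : IsBaerStarRing N) {M : ℝ} {y : N}
    (h : ∀ ε > 0, ∃ z, ‖z‖ ≤ M ∧ SmallInMeasure δ ε (z - y)) : ‖y‖ ≤ M := by
  let _ := CStarAlgebra.spectralOrder N
  have _ := CStarAlgebra.spectralOrderedRing N
  by_contra! hlt
  obtain ⟨M', hM1, hM2⟩ := exists_between hlt
  have hM0 : 0 ≤ M := by
    obtain ⟨z, hz, -⟩ := h 1 one_pos
    exact (norm_nonneg z).trans hz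
  set a := star y * y with ha
  have hsa : IsSelfAdjoint a := IsSelfAdjoint.star_mul_self y
  set e := specProj hN a (M' ^ 2) with he
  have hep : IsStarProjection e := specProj_proj hN _ _
  set g := cfc (fun s : ℝ => max (s - M' ^ 2) 0) a with hg
  have hge : g * e = g := mul_supp hN (Set.mem_singleton _)
  have hM'0 : 0 < M' := hM0.trans_lt hM1
  have he0 : e ≠ 0 := by
    intro h0
    rw [h0, mul_zero] at hge
    have h1 : a = cfc (fun s : ℝ => s - max (s - M' ^ 2) 0) a := by
      rw [cfc_sub _ _ a (by fun_prop) (by fun_prop), ← hg, ← hge, sub_zero, cfc_id' ℝ a]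
    have h2 : ‖a‖ ≤ M' ^ 2 := by
      rw [h1]
      refine norm_cfc_le (sq_nonneg _) fun s hs => ?_
      have := spectrum_star_mul_self_nonneg s hs
      have := sq_nonneg M'
      rw [Real.norm_eq_abs, abs_le]
      rcases le_total (s - M' ^ 2) 0 with h | h
      · rw [max_eq_right h]; constructor <;> linarith
      · rw [max_eq_left h]; constructor <;> linarith
    rw [ha, CStarRing.norm_star_mul_self] at h2
    nlinarith
  have hδe : 0 < δ e := (hδ.nonneg e hep).lt_of_ne fun h0 => he0 (hδ.faithful e hep h0.symm)
  -- The first bound makes `p` too large to have zero meet with `e`; the second keeps `‖y * r‖`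
  -- below `M'` on that meet `r`.
  obtain ⟨z, hz, p, hp, hp1, hp2⟩ := h (min (δ e / 2) ((M' - M) / 2))
    (lt_min (by linarith) (by linarith))
  obtain ⟨r, hr, her, hpr, hle⟩ := hδ.exists_meet hN hep hp
  have hr0 : r ≠ 0 := by
    rintro rfl
    rw [sub_zero, hδ.one_sub hep] at hle
    have := hp1.trans (min_le_left _ _)
    linarith
  -- Under `e` one has `a = M' ^ 2 + g` with `g ≥ 0`, so `‖y * r‖` is at least `M'`, the
  -- contradiction sought.
  have h1 : r * a * r = (M' ^ 2) • r + r * g * r := by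
    have h2 : cfc (fun s : ℝ => s - M' ^ 2) a * e = g * e :=
      cfc_mul_specProj_congr hN a (by fun_prop) (by fun_prop) fun s hs => by
        rw [max_eq_left (sub_nonneg.2 hs)]
    have h3 : cfc (fun s : ℝ => s - M' ^ 2) a = a - (M' ^ 2) • (1 : N) := by
      rw [cfc_sub _ _ a (by fun_prop) (by fun_prop), cfc_id' ℝ a, cfc_const _ a,
        Algebra.algebraMap_eq_smul_one]
    have h4 : (a - (M' ^ 2) • (1 : N)) * r = g * r := by
      rw [← her, ← mul_assoc, ← mul_assoc, ← h3, h2]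
    rw [sub_mul, sub_eq_iff_eq_add, smul_mul_assoc, one_mul] at h4
    rw [mul_assoc, h4, mul_add, mul_smul_comm, hr.mul_self, ← mul_assoc, add_comm]
  have hg0 : 0 ≤ g := cfc_nonneg fun s _ => le_max_right _ _
  have hrgr : 0 ≤ r * g * r := by
    have := star_left_conjugate_nonneg hg0 r
    rwa [hr.star_eq] at this
  have hr_nonneg : 0 ≤ r := by
    have := star_mul_self_nonneg r
    rwa [hr.star_eq, hr.mul_self] at this
  have h2 : M' ^ 2 ≤ ‖y * r‖ ^ 2 := by
    have h3 : ‖(M' ^ 2) • r‖ ≤ ‖r * a * r‖ :=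
      CStarAlgebra.norm_le_norm_of_nonneg_of_le (smul_nonneg (sq_nonneg _) hr_nonneg)
        (h1 ▸ le_add_of_nonneg_right hrgr)
    rw [norm_smul, hr.norm_eq_one hr0, mul_one, Real.norm_of_nonneg (sq_nonneg _)] at h3
    rw [sq ‖y * r‖, ← CStarRing.norm_star_mul_self, star_mul, hr.star_eq]
    simpa only [ha, mul_assoc] using h3
  have h3 : ‖y * r‖ ≤ M + (M' - M) / 2 := by
    have h4 : y * r = z * r - (z - y) * r := by rw [sub_mul, sub_sub_cancel]
    rw [h4]
    refine (norm_sub_le _ _).trans (add_le_add ?_ ?_)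
    · exact (norm_mul_le _ _).trans ((mul_le_of_le_one_right (norm_nonneg _) hr.norm_le_one).trans hz)
    · exact (SmallInMeasure.norm_mul_le_of_mul_eq hr hpr).trans (hp2.trans (min_le_right _ _))
  have h4 : M' ≤ ‖y * r‖ := by
    by_contra h5
    nlinarith [norm_nonneg (y * r)]
  linarith

/-- Convergence in measure. -/
def TendstoInMeas (δ : N → ℝ) (f : ℕ → N) (y : N) : Prop :=
  ∀ ε > 0, ∀ᶠ n in atTop, SmallInMeasure δ ε (f n - y)

namespace TendstoInMeas

variable {f g : ℕ → N} {y z : N}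

theorem norm_le (hδ : IsDimension δ) (hN : IsBaerStarRing N) (hf : TendstoInMeas δ f y) {M : ℝ}
    (hM : ∀ n, ‖f n‖ ≤ M) : ‖y‖ ≤ M :=
  norm_le_of_smallInMeasure hδ hN fun ε hε => by
    obtain ⟨n, hn⟩ := (hf ε hε).exists
    exact ⟨f n, hM n, hn⟩

theorem const (hδ : IsDimension δ) (y : N) : TendstoInMeas δ (fun _ => y) y := fun ε hε =>
  Eventually.of_forall fun _ => .of_norm_le hδ (by rw [sub_self, norm_zero]; exact hε.le)

theorem add (hδ : IsDimension δ) (hN : IsBaerStarRing N) (hf : TendstoInMeas δ f y)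
    (hg : TendstoInMeas δ g z) : TendstoInMeas δ (fun n => f n + g n) (y + z) := fun ε hε => by
  filter_upwards [hf _ (half_pos hε), hg _ (half_pos hε)] with n h1 h2
  have := h1.add hδ hN h2
  rwa [add_halves, sub_add_sub_comm] at this

theorem neg (hf : TendstoInMeas δ f y) : TendstoInMeas δ (fun n => -f n) (-y) := fun ε hε => by
  filter_upwards [hf _ hε] with n h1
  have := h1.neg
  rwa [neg_sub, ← neg_sub_neg] at this

theorem sub (hδ : IsDimension δ) (hN : IsBaerStarRing N) (hf : TendstoInMeas δ f y)
    (hg : TendstoInMeas δ g z) : TendstoInMeas δ (fun n => f n - g n) (y - z) := by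
  simpa only [sub_eq_add_neg] using hf.add hδ hN hg.neg

theorem star (hδ : IsDimension δ) (hN : IsBaerStarRing N) (hf : TendstoInMeas δ f y) :
    TendstoInMeas δ (fun n => star (f n)) (star y) := fun ε hε => by
  filter_upwards [hf _ hε] with n h1
  simpa only [star_sub] using h1.star hδ hN

theorem mul (hδ : IsDimension δ) (hN : IsBaerStarRing N) (hf : TendstoInMeas δ f y)
    (hg : TendstoInMeas δ g z) {M : ℝ} (hM : ∀ n, ‖f n‖ ≤ M) :
    TendstoInMeas δ (fun n => f n * g n) (y * z) := fun ε hε => by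
  -- The split is `f g - y z = f (g - z) + (f - y) z`; `K` bounds both outer factors and is at least
  -- `1`, as `mul_left` and `mul_right` require.
  set K := max M (max ‖z‖ 1)
  have hK1 : 1 ≤ K := (le_max_right _ _).trans (le_max_right _ _)
  have hK : 0 < K := zero_lt_one.trans_le hK1
  have hε' : 0 < ε / 2 / K := div_pos (half_pos hε) hK
  filter_upwards [hf _ hε', hg _ hε'] with n h1 h2
  have h3 := (h2.mul_left hK1 ((hM n).trans (le_max_left _ _))).add hδ hN
    (h1.mul_right hδ hN (y := z) hK1 ((le_max_left _ _).trans (le_max_right _ _)))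
  have h4 : K * (ε / 2 / K) + K * (ε / 2 / K) = ε := by
    rw [mul_div_cancel₀ _ hK.ne', add_halves]
  rw [h4] at h3
  convert h3 using 1
  noncomm_ring

/-- Lower semicontinuity with bound `0`, applied to the zero sequence `f n - f n`. -/
theorem unique (hδ : IsDimension δ) (hN : IsBaerStarRing N) (hf : TendstoInMeas δ f y)
    (hg : TendstoInMeas δ f z) : y = z := by
  have h := hf.sub hδ hN hg
  have := h.norm_le hδ hN (M := 0) fun n => by rw [sub_self, norm_zero]
  exact sub_eq_zero.1 (norm_le_zero_iff.1 this)

end TendstoInMeas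

end Measure

/-! ### Norm-controlled lifts through *-homomorphisms -/

section Range

variable {D N : Type*} [CStarAlgebra D] [CStarAlgebra N]

theorem StarAlgHom.norm_map_le (φ : D →⋆ₐ[ℂ] N) (d : D) : ‖φ d‖ ≤ ‖d‖ :=
  NonUnitalStarAlgHom.norm_apply_le φ d

theorem StarAlgHom.continuous_of_cstar (φ : D →⋆ₐ[ℂ] N) : Continuous φ :=
  AddMonoidHomClass.continuous_of_bound φ 1 fun d => by
    rw [one_mul]; exact φ.norm_map_le d

theorem StarAlgHom.map_cfc_real (φ : D →⋆ₐ[ℂ] N) {f : ℝ → ℝ} (hf : Continuous f) {d : D}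
    (hd : IsSelfAdjoint d) : φ (cfc f d) = cfc f (φ d) :=
  StarAlgHom.map_cfc φ f d hf.continuousOn φ.continuous_of_cstar hd (hd.map φ)

theorem cfc_star_mul_self_mem_range (φ : D →⋆ₐ[ℂ] N) {f : ℝ → ℝ} (hf : Continuous f) {x : N}
    (hx : x ∈ φ.range) : cfc f (star x * x) ∈ φ.range := by
  obtain ⟨d, rfl⟩ := hx
  refine ⟨cfc f (star d * d), ?_⟩
  change φ _ = cfc f (star (φ d) * φ d)
  rw [φ.map_cfc_real hf (.star_mul_self d), map_mul, map_star]

/-- The self-adjoint part of any lift is truncated to `[-‖b‖, ‖b‖]` by functional calculus; `φ`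
commutes with the truncation, which fixes `b`. -/
theorem exists_lift_of_isSelfAdjoint (φ : D →⋆ₐ[ℂ] N) {b : N} (hb : b ∈ φ.range)
    (hsa : IsSelfAdjoint b) : ∃ d, φ d = b ∧ ‖d‖ ≤ ‖b‖ := by
  obtain ⟨d₀, h₀⟩ := hb
  replace h₀ : φ d₀ = b := h₀
  set d : D := (1 / 2 : ℂ) • (d₀ + star d₀) with hd
  have hdsa : IsSelfAdjoint d := by
    rw [IsSelfAdjoint, hd, star_smul, star_add, star_star, add_comm]
    simp
  have hφd : φ d = b := by
    rw [hd, map_smul, map_add, map_star, h₀, hsa.star_eq, ← two_smul ℂ b, smul_smul]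
    norm_num
  set M := ‖b‖
  refine ⟨cfc (fun s : ℝ => max (-M) (min s M)) d, ?_, ?_⟩
  · rw [φ.map_cfc_real (by fun_prop) hdsa, hφd]
    conv_rhs => rw [← cfc_id' ℝ b]
    refine cfc_congr fun s hs => ?_
    have h := IsometricContinuousFunctionalCalculus.norm_spectrum_le b hs hsa
    rw [Real.norm_eq_abs, abs_le] at h
    rw [min_eq_left h.2, max_eq_right h.1]
  · refine norm_cfc_le (norm_nonneg _) fun s _ => ?_
    have hM : 0 ≤ M := norm_nonneg _
    rw [Real.norm_eq_abs, abs_le]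
    exact ⟨le_max_left _ _, max_le (by linarith) (min_le_right _ _)⟩

/-- The factor `2` comes from lifting real and imaginary parts separately; only boundedness of the
lifts matters later. -/
theorem exists_lift_norm_le (φ : D →⋆ₐ[ℂ] N) {b : N} (hb : b ∈ φ.range) :
    ∃ d, φ d = b ∧ ‖d‖ ≤ 2 * ‖b‖ := by
  have hbs : star b ∈ φ.range := star_mem hb
  have hre : (1 / 2 : ℂ) • (b + star b) ∈ φ.range := SMulMemClass.smul_mem _ (add_mem hb hbs)
  have him : (-Complex.I / 2 : ℂ) • (b - star b) ∈ φ.range :=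
    SMulMemClass.smul_mem _ (sub_mem hb hbs)
  obtain ⟨d₁, h₁, n₁⟩ := exists_lift_of_isSelfAdjoint φ hre (by
    rw [IsSelfAdjoint, star_smul, star_add, star_star, add_comm]; simp)
  obtain ⟨d₂, h₂, n₂⟩ := exists_lift_of_isSelfAdjoint φ him (by
    rw [IsSelfAdjoint, star_smul, star_sub, star_star, ← neg_sub b, smul_neg, ← neg_smul]
    congr 1
    simp [neg_div])
  have hn₁ : ‖(1 / 2 : ℂ) • (b + star b)‖ ≤ ‖b‖ := by
    rw [norm_smul]
    have := norm_add_le b (star b)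
    rw [norm_star] at this
    norm_num
    linarith
  have hn₂ : ‖(-Complex.I / 2 : ℂ) • (b - star b)‖ ≤ ‖b‖ := by
    rw [norm_smul]
    have := norm_sub_le b (star b)
    rw [norm_star] at this
    norm_num
    linarith
  refine ⟨d₁ + Complex.I • d₂, ?_, ?_⟩
  · rw [map_add, map_smul, h₁, h₂, smul_smul]
    have : Complex.I * (-Complex.I / 2) = 1 / 2 := by
      rw [mul_div_assoc', mul_neg, Complex.I_mul_I, neg_neg]
    rw [this, ← smul_add, add_add_sub_cancel, ← two_smul ℂ b, smul_smul]
    norm_num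
  · refine (norm_add_le _ _).trans ?_
    rw [norm_smul, Complex.norm_I, one_mul]
    linarith

end Range

/-! ### The closure of `A` in measure is an AW*-subalgebra -/

section Sequences

variable {N : Type*} [CStarAlgebra N] {δ : N → ℝ}

/-- Here `b n` coincides with `p` off the projection `p - e n`, whose dimension tends to `0`. -/
theorem tendstoInMeas_of_mul_eq_zero (hδ : IsDimension δ) {b e : ℕ → N} {p : N}
    (hp : IsStarProjection p) (he : ∀ n, IsStarProjection (e n)) (hep : ∀ n, e n * p = e n)
    (hlim : Tendsto (fun n => δ (e n)) atTop (𝓝 (δ p)))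
    (h0 : ∀ n, (b n - p) * (1 - (p - e n)) = 0) : TendstoInMeas δ b p := fun ε hε => by
  filter_upwards [hlim.eventually_const_le (sub_lt_self _ hε)] with n hn
  refine ⟨1 - (p - e n), ((he n).sub_of_mul_eq_left hp (hep n)).one_sub, ?_, ?_⟩
  · rw [sub_sub_cancel, hδ.map_sub (he n) hp (hep n)]
    linarith
  · rw [h0, norm_zero]
    exact hε.le

theorem continuous_div_max {t : ℝ} (ht : 0 < t) : Continuous fun s : ℝ => s / max s t :=
  Continuous.div (by fun_prop) (by fun_prop) fun _ => (ht.trans_le (le_max_right _ _)).ne'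

theorem norm_cfc_div_max_le (x : N) {t : ℝ} (ht : 0 < t) :
    ‖cfc (fun s : ℝ => s / max s t) (star x * x)‖ ≤ 1 := by
  refine norm_cfc_le zero_le_one fun s hs => ?_
  have h1 := spectrum_star_mul_self_nonneg s hs
  have h2 := ht.trans_le (le_max_right s t)
  rw [Real.norm_of_nonneg (div_nonneg h1 h2.le)]
  exact (div_le_one h2).2 (le_max_left _ _)

/-- The support of `x` is approximated in measure by continuous functions of `x⋆x`. -/
theorem tendstoInMeas_supp (hδ : IsDimension δ) (hN : IsBaerStarRing N) (s : N) :
    TendstoInMeas δ (fun n => cfc (fun t : ℝ => t / max t (thr n)) (star s * s))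
      (supp hN {s}) := by
  set h := star s * s with hh
  set p := supp hN {s} with hp
  have hpp : IsStarProjection p := supp_proj hN _
  have hhp : h * p = h := by
    rw [hh, mul_assoc, hp, mul_supp hN (Set.mem_singleton s)]
  have hc : ∀ n, Continuous fun t : ℝ => t / max t (thr n) := fun n =>
    continuous_div_max (thr_pos n)
  have hsup := IsDimension.isProjectionSup_specProj hN s
  have hep : ∀ n, specProj hN h (thr n) * p = specProj hN h (thr n) := fun n =>
    hsup.2.1 _ ⟨n, rfl⟩
  refine tendstoInMeas_of_mul_eq_zero hδ (e := fun n => specProj hN h (thr n)) hpp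
    (fun n => specProj_proj hN _ _) hep
    (hδ.tendsto_of_monotone (fun n => specProj_proj hN _ _)
      (fun m n hmn => specProj_mul_of_le hN h (thr_anti hmn)) hsup) fun n => ?_
  -- The function of `h` acts as the identity on the spectral projection and vanishes off `p`, so it
  -- differs from `p` only on the difference of the two.
  have h1 : cfc (fun t : ℝ => t / max t (thr n)) h * specProj hN h (thr n) =
      specProj hN h (thr n) := by
    rw [cfc_mul_specProj_congr hN h (g := fun _ => 1) (hc n) continuous_const fun t ht => ?_,
      cfc_const_one ℝ h, one_mul]
    rw [max_eq_left ht, div_self ((thr_pos n).trans_le ht).ne']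
  have h2 : cfc (fun t : ℝ => t / max t (thr n)) h * p =
      cfc (fun t : ℝ => t / max t (thr n)) h := by
    have h3 := cfc_mul (fun t : ℝ => 1 / max t (thr n)) (fun t => t) h
      (Continuous.continuousOn <| Continuous.div (by fun_prop) (by fun_prop) fun s =>
        ((thr_pos n).trans_le (le_max_right _ _)).ne') (by fun_prop)
    rw [cfc_id' ℝ h] at h3
    simp only [one_div_mul_eq_div] at h3
    rw [h3, mul_assoc, hhp]
  have h5 : p * specProj hN h (thr n) = specProj hN h (thr n) :=
    (specProj_proj hN h (thr n)).mul_eq_left_comm hpp (hep n)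
  rw [mul_sub, mul_sub, mul_one, sub_mul _ p p, sub_mul _ p (specProj _ _ _), h1, h2, h5,
    hpp.mul_self]
  abel

/-- The bounded sequences in `A` that converge in measure to an element of `N`. -/
def convSeq (hδ : IsDimension δ) (hN : IsBaerStarRing N) (A : StarSubalgebra ℂ N) :
    StarSubalgebra ℂ (ℕ →ᵇ A) where
  carrier := {f | ∃ y, TendstoInMeas δ (fun n => (f n : N)) y}
  mul_mem' := by
    rintro f g ⟨y, hy⟩ ⟨z, hz⟩
    exact ⟨y * z, hy.mul hδ hN hz (M := ‖f‖) fun n => f.norm_coe_le_norm n⟩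
  add_mem' := by
    rintro f g ⟨y, hy⟩ ⟨z, hz⟩
    exact ⟨y + z, hy.add hδ hN hz⟩
  algebraMap_mem' c := ⟨algebraMap ℂ N c, .const hδ _⟩
  star_mem' := by
    rintro f ⟨y, hy⟩
    exact ⟨star y, hy.star hδ hN⟩

variable (hδ : IsDimension δ) (hN : IsBaerStarRing N) (A : StarSubalgebra ℂ N)

/-- The limit in measure. -/
def limInMeas (f : convSeq hδ hN A) : N := f.2.choose

variable {A} in
theorem tendsto_limInMeas (f : convSeq hδ hN A) :
    TendstoInMeas δ (fun n => ((f : ℕ →ᵇ A) n : N)) (limInMeas hδ hN A f) := f.2.choose_spec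

variable {A} in
theorem limInMeas_eq {f : convSeq hδ hN A} {y : N}
    (h : TendstoInMeas δ (fun n => ((f : ℕ →ᵇ A) n : N)) y) : limInMeas hδ hN A f = y :=
  (tendsto_limInMeas hδ hN f).unique hδ hN h

theorem norm_limInMeas_le (f : convSeq hδ hN A) :
    ‖limInMeas hδ hN A f‖ ≤ ‖(f : ℕ →ᵇ A)‖ :=
  (tendsto_limInMeas hδ hN f).norm_le hδ hN fun n => (f : ℕ →ᵇ A).norm_coe_le_norm n

/-- Taking limits in measure is contractive, so the limits of a norm-convergent sequence of
sequences are Cauchy; an `ε / 3` argument shows that their norm limit is the required limit in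
measure. -/
instance isClosed_convSeq : IsClosed (convSeq hδ hN A : Set (ℕ →ᵇ A)) := by
  refine IsSeqClosed.isClosed fun F f hF hlim => ?_
  let G : ℕ → convSeq hδ hN A := fun k => ⟨F k, hF k⟩
  have hG : CauchySeq fun k => limInMeas hδ hN A (G k) := by
    rw [Metric.cauchySeq_iff']
    intro ε hε
    obtain ⟨K, hK⟩ := Metric.cauchySeq_iff'.1 hlim.cauchySeq ε hε
    refine ⟨K, fun n hn => (hK n hn).trans_le' ?_⟩
    rw [dist_eq_norm, dist_eq_norm]
    have := norm_limInMeas_le hδ hN A (G n - G K)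
    have h2 : limInMeas hδ hN A (G n - G K) = limInMeas hδ hN A (G n) - limInMeas hδ hN A (G K) :=
      limInMeas_eq hδ hN ((tendsto_limInMeas hδ hN (G n)).sub hδ hN (tendsto_limInMeas hδ hN (G K)))
    rwa [h2] at this
  obtain ⟨y, hy⟩ := cauchySeq_tendsto_of_complete hG
  refine ⟨y, fun ε hε => ?_⟩
  have hε3 : 0 < ε / 3 := by linarith
  obtain ⟨k, h1, h2⟩ := ((Metric.tendsto_nhds.1 hy _ hε3).and
    (Metric.tendsto_nhds.1 hlim _ hε3)).exists
  filter_upwards [tendsto_limInMeas hδ hN (G k) _ hε3] with n hn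
  have h3 : SmallInMeasure δ (ε / 3) ((f n : N) - F k n) := by
    refine .of_norm_le hδ ?_
    have := (f - F k).norm_coe_le_norm n
    rw [← dist_eq_norm, dist_comm] at this
    exact this.trans h2.le
  have h4 : SmallInMeasure δ (ε / 3) (limInMeas hδ hN A (G k) - y) :=
    .of_norm_le hδ (by rw [← dist_eq_norm]; exact h1.le)
  have := (h3.add hδ hN hn).add hδ hN h4
  convert this using 1
  · ring
  · change _ = (f n : N) - F k n + ((F k n : N) - limInMeas hδ hN A (G k)) + _
    abel

variable [hA : IsClosed (A : Set N)]

/-- The C*-algebra of bounded sequences in `A` that converge in measure. -/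
def ConvSeq : Type _ := convSeq hδ hN A

instance : CStarAlgebra (ConvSeq hδ hN A) := inferInstanceAs (CStarAlgebra (convSeq hδ hN A))

/-- Evaluation of a sequence at `n`. -/
def evalHom (n : ℕ) : ConvSeq hδ hN A →⋆ₐ[ℂ] A where
  toFun f := f.1 n
  map_one' := rfl
  map_zero' := rfl
  map_mul' _ _ := rfl
  map_add' _ _ := rfl
  commutes' _ := rfl
  map_star' _ := rfl

theorem norm_evalHom_le (n : ℕ) (f : ConvSeq hδ hN A) : ‖evalHom hδ hN A n f‖ ≤ ‖f‖ :=
  f.1.norm_coe_le_norm n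

/-- The limit in measure as a *-homomorphism. -/
def limHom : ConvSeq hδ hN A →⋆ₐ[ℂ] N where
  toFun f := limInMeas hδ hN A f
  map_one' := limInMeas_eq hδ hN (.const hδ 1)
  map_zero' := limInMeas_eq hδ hN (.const hδ 0)
  map_mul' f g := limInMeas_eq hδ hN <| (tendsto_limInMeas hδ hN f).mul hδ hN
    (tendsto_limInMeas hδ hN g) (M := ‖f.1‖) fun n => f.1.norm_coe_le_norm n
  map_add' f g := limInMeas_eq hδ hN <|
    (tendsto_limInMeas hδ hN f).add hδ hN (tendsto_limInMeas hδ hN g)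
  commutes' c := limInMeas_eq hδ hN (.const hδ (algebraMap ℂ N c))
  map_star' f := limInMeas_eq hδ hN <| (tendsto_limInMeas hδ hN f).star hδ hN

variable {A} in
theorem tendsto_limHom (f : ConvSeq hδ hN A) :
    TendstoInMeas δ (fun n => (evalHom hδ hN A n f : N)) (limHom hδ hN A f) :=
  tendsto_limInMeas hδ hN f

/-- The limits in measure of bounded sequences in `A`. -/
def measClosure : StarSubalgebra ℂ N := (limHom hδ hN A).range

variable {A} in
theorem mem_measClosure_of_seq {a : ℕ → N} (ha : ∀ n, a n ∈ A) {M : ℝ} (hM : ∀ n, ‖a n‖ ≤ M)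
    {y : N} (hy : TendstoInMeas δ a y) : y ∈ measClosure hδ hN A := by
  let f : ℕ →ᵇ A := BoundedContinuousFunction.ofNormedAddCommGroupDiscrete (fun n => ⟨a n, ha n⟩) M hM
  let d : ConvSeq hδ hN A := (⟨f, y, hy⟩ : convSeq hδ hN A)
  have hd : limHom hδ hN A d = y := (tendsto_limHom hδ hN d).unique hδ hN hy
  rw [← hd]
  exact ⟨d, rfl⟩

theorem le_measClosure : A ≤ measClosure hδ hN A := fun a ha =>
  mem_measClosure_of_seq hδ hN (fun _ => ha) (fun _ => le_rfl) (.const hδ a)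

variable {A}

/-- Kaplansky density. -/
theorem exists_seq_of_mem_measClosure {b : N} (hb : b ∈ measClosure hδ hN A) :
    ∃ a : ℕ → N, (∀ n, a n ∈ A) ∧ (∀ n, ‖a n‖ ≤ 2 * ‖b‖) ∧ TendstoInMeas δ a b := by
  obtain ⟨d, rfl, hd⟩ := exists_lift_norm_le (limHom hδ hN A) hb
  exact ⟨fun n => evalHom hδ hN A n d, fun n => (evalHom hδ hN A n d).2,
    fun n => (norm_evalHom_le hδ hN A n d).trans hd, tendsto_limHom hδ hN d⟩

/-- A diagonal argument; the norm control in `exists_seq_of_mem_measClosure` keeps the diagonal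
sequence bounded. -/
theorem mem_measClosure_of_tendstoInMeas {b : ℕ → N} (hb : ∀ n, b n ∈ measClosure hδ hN A) {M : ℝ}
    (hM : ∀ n, ‖b n‖ ≤ M) {y : N} (hy : TendstoInMeas δ b y) : y ∈ measClosure hδ hN A := by
  have h : ∀ n, ∃ a ∈ A, ‖a‖ ≤ 2 * M ∧ SmallInMeasure δ (thr n) (a - b n) := fun n => by
    obtain ⟨a, ha, hna, hta⟩ := exists_seq_of_mem_measClosure hδ hN (hb n)
    obtain ⟨k, hk⟩ := (hta _ (thr_pos n)).exists
    exact ⟨a k, ha k, (hna k).trans (by linarith [hM n]), hk⟩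
  choose a ha hna hs using h
  refine mem_measClosure_of_seq hδ hN ha hna fun ε hε => ?_
  filter_upwards [hy _ (half_pos hε), tendsto_thr.eventually_le_const (half_pos hε)] with n h1 h2
  have := ((hs n).mono h2).add hδ hN h1
  rwa [add_halves, sub_add_sub_cancel] at this

variable (A) in
theorem isClosed_measClosure : IsClosed (measClosure hδ hN A : Set N) := by
  refine IsSeqClosed.isClosed fun b y hb hy => ?_
  obtain ⟨M, hM⟩ := (Metric.isBounded_range_of_tendsto b hy).exists_norm_le
  refine mem_measClosure_of_tendstoInMeas hδ hN hb (M := M) (fun n => hM _ ⟨n, rfl⟩) fun ε hε => ?_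
  filter_upwards [Metric.tendsto_nhds.1 hy ε hε] with n hn
  exact .of_norm_le hδ (by rw [← dist_eq_norm]; exact hn.le)

theorem supp_singleton_mem_measClosure {s : N} (hs : s ∈ measClosure hδ hN A) :
    supp hN {s} ∈ measClosure hδ hN A :=
  mem_measClosure_of_tendstoInMeas hδ hN
    (fun n => cfc_star_mul_self_mem_range (limHom hδ hN A) (continuous_div_max (thr_pos n)) hs)
    (fun n => norm_cfc_div_max_le s (thr_pos n)) (tendstoInMeas_supp hδ hN s)

theorem supp_pair_mem_measClosure {p q : N} (hq : IsStarProjection q)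
    (hpm : p ∈ measClosure hδ hN A) (hqm : q ∈ measClosure hδ hN A) :
    supp hN {p, q} ∈ measClosure hδ hN A := by
  have h := supp_singleton_mem_measClosure hδ hN
    (mul_mem hpm (sub_mem (one_mem _) hqm) : p * (1 - q) ∈ measClosure hδ hN A)
  rw [supp_pair_sub hN hq] at h
  simpa using add_mem h hqm

theorem supp_range_mem_measClosure {e : ℕ → N} (he : ∀ n, IsStarProjection (e n))
    (hmono : ∀ m n, m ≤ n → e m * e n = e m) (hem : ∀ n, e n ∈ measClosure hδ hN A) :
    supp hN (Set.range e) ∈ measClosure hδ hN A := by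
  have hsup := isProjectionSup_supp hN (Set.range e)
  refine mem_measClosure_of_tendstoInMeas hδ hN hem (fun n => (he n).norm_le_one)
    (tendstoInMeas_of_mul_eq_zero hδ hsup.1 he (fun n => hsup.2.1 _ ⟨n, rfl⟩)
      (hδ.tendsto_of_monotone he hmono hsup) fun n => ?_)
  have h1 := hsup.2.1 _ ⟨n, rfl⟩
  have h2 := (he n).mul_eq_left_comm hsup.1 h1
  rw [mul_sub, mul_sub, mul_one, sub_mul, sub_mul, h1, h2, hsup.1.mul_self, (he n).mul_self]
  abel

/-- Exhaustion. The projections of the closure lying under `E` are directed upwards, and an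
increasing sequence of them reaches the supremum of their dimensions. Its join `E'` lies in the
closure and has maximal dimension, so by faithfulness joining any `p ∈ P` to it adds nothing, and
`E' = E`. Suprema of arbitrary families thus reduce to sequences. -/
theorem supp_mem_measClosure {P : Set N} (hP : ∀ p ∈ P, IsStarProjection p)
    (hPm : P ⊆ measClosure hδ hN A) : supp hN P ∈ measClosure hδ hN A := by
  set E := supp hN P with hE
  have hEp : IsStarProjection E := supp_proj hN _
  set F : Set N := {q | IsStarProjection q ∧ q ∈ measClosure hδ hN A ∧ q * E = q} with hF
  have hjoin : ∀ p ∈ F, ∀ q ∈ F, supp hN {p, q} ∈ F := by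
    rintro p ⟨hp, hpm, hpE⟩ q ⟨hq, hqm, hqE⟩
    refine ⟨supp_proj hN _, supp_pair_mem_measClosure hδ hN hq hpm hqm, supp_mul_eq hN ?_⟩
    rintro s (rfl | rfl)
    exacts [hpE, hqE]
  have hbdd : BddAbove (δ '' F) := ⟨δ E, by
    rintro _ ⟨q, ⟨hq, -, hqE⟩, rfl⟩
    exact hδ.mono hq hEp hqE⟩
  have hne : (δ '' F).Nonempty := ⟨_, 0, ⟨.zero N, zero_mem _, zero_mul _⟩, rfl⟩
  obtain ⟨u, -, hu, huF⟩ := exists_seq_tendsto_sSup hne hbdd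
  choose q hqF hqu using huF
  let r : ℕ → N := fun n => Nat.rec (q 0) (fun n x => supp hN {x, q (n + 1)}) n
  have hrF : ∀ n, r n ∈ F := fun n => by
    induction n with
    | zero => exact hqF 0
    | succ n ih => exact hjoin _ ih _ (hqF (n + 1))
  have hrr : ∀ m n, m ≤ n → r m * r n = r m := fun m n hmn => by
    induction n, hmn using Nat.le_induction with
    | base => exact (hrF m).1.mul_self
    | succ n _ ih =>
      have : r n * r (n + 1) = r n := mul_supp hN (S := {r n, q (n + 1)}) (by simp)
      rw [← ih, mul_assoc, this]
  have hqr : ∀ n, q n * r n = q n := fun n => by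
    cases n with
    | zero => exact (hqF 0).1.mul_self
    | succ n => exact mul_supp hN (S := {r n, q (n + 1)}) (by simp)
  set E' := supp hN (Set.range r) with hE'
  have hE'p : IsStarProjection E' := supp_proj hN _
  have hE'F : E' ∈ F := by
    refine ⟨hE'p, supp_range_mem_measClosure hδ hN (fun n => (hrF n).1) hrr fun n => (hrF n).2.1,
      supp_mul_eq hN ?_⟩
    rintro _ ⟨n, rfl⟩
    exact (hrF n).2.2
  have hmax : ∀ p ∈ F, δ p ≤ δ E' := fun p hp => by
    refine (le_csSup hbdd ⟨p, hp, rfl⟩).trans (le_of_tendsto' hu fun n => ?_)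
    rw [← hqu n]
    exact (hδ.mono (hqF n).1 (hrF n).1 (hqr n)).trans
      (hδ.mono (hrF n).1 hE'p (mul_supp hN ⟨n, rfl⟩))
  have hle : ∀ p ∈ P, p * E' = p := fun p hp => by
    have hpF : p ∈ F := ⟨hP p hp, hPm hp, mul_supp hN hp⟩
    have h1 := hjoin p hpF E' hE'F
    have h2 : E' * supp hN {p, E'} = E' := mul_supp hN (by simp)
    have h3 := hδ.map_sub hE'p h1.1 h2
    have h4 := hE'p.sub_of_mul_eq_left h1.1 h2
    have h5 := hδ.faithful _ h4 (le_antisymm (by linarith [hmax _ h1]) (hδ.nonneg _ h4))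
    rw [sub_eq_zero] at h5
    rw [← h5]
    exact mul_supp hN (by simp)
  have : E = E' := hEp.eq_of_le_of_le hE'p (supp_mul_eq hN hle) hE'F.2.2
  rw [this]
  exact hE'F.2.1

variable (A) in
theorem isAWStarSubalgebra_measClosure : IsAWStarSubalgebra (measClosure hδ hN A) := by
  refine ⟨isClosed_measClosure hδ hN A, fun S => ?_, fun P hPm hP e he => ?_⟩
  -- The right annihilator of `S` is that of the join of the supports of its elements, and this join
  -- stays in the closure.
  · set P : Set N := (fun s : measClosure hδ hN A => supp hN {(s : N)}) '' S with hP
    have hPm : supp hN P ∈ measClosure hδ hN A := supp_mem_measClosure hδ hN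
      (by rintro _ ⟨s, -, rfl⟩; exact supp_proj hN _)
      (by rintro _ ⟨s, -, rfl⟩; exact supp_singleton_mem_measClosure hδ hN s.2)
    have hPp : IsStarProjection (supp hN P) := supp_proj hN P
    refine ⟨1 - ⟨supp hN P, hPm⟩, IsStarProjection.one_sub
      ⟨Subtype.ext hPp.mul_self, Subtype.ext hPp.star_eq⟩, fun x => ?_⟩
    have key : supp hN P * (x : N) = 0 ↔ ∀ s ∈ S, s * x = 0 := by
      rw [supp_mul_eq_zero]
      simp only [hP, Set.forall_mem_image, supp_singleton_mul_eq_zero]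
      exact forall₂_congr fun s _ => ⟨fun h => Subtype.ext h, fun h => congrArg Subtype.val h⟩
    rw [← key]
    constructor
    · intro h
      refine ⟨x, Subtype.ext ?_⟩
      change (x : N) = (1 - supp hN P) * x
      rw [sub_mul, one_mul, h, sub_zero]
    · rintro ⟨y, rfl⟩
      change supp hN P * ((1 - supp hN P) * (y : N)) = 0
      rw [← mul_assoc, hPp.mul_one_sub_self, zero_mul]
  · rw [he.eq_supp hN]
    exact supp_mem_measClosure hδ hN hP.1 hPm

variable (A) in
theorem awStarClosure_le_measClosure : awStarClosure A ≤ measClosure hδ hN A :=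
  sInf_le ⟨isAWStarSubalgebra_measClosure hδ hN A, le_measClosure hδ hN A⟩

end Sequences

/-! ### The minimal tensor norm as a C*-seminorm -/

section MinNorm

variable {A B : Type u}

section NonUnital

variable [NonUnitalCStarAlgebra A] [NonUnitalCStarAlgebra B]

theorem HilbertRep.tensor_tmul_tmul (π : HilbertRep A) (σ : HilbertRep B) (a : A) (b : B)
    (v : π.space) (w : σ.space) :
    π.tensor σ (a ⊗ₜ[ℂ] b) (v ⊗ₜ w) = π.rep a v ⊗ₜ σ.rep b w := rfl

theorem norm_tensor_le (π : HilbertRep A) (σ : HilbertRep B) (x : A ⊗[ℂ] B) :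
    ‖π.tensor σ x‖ ≤ minTensorNorm x :=
  le_ciSup (minTensorNorm_bddAbove x) (π, σ)

theorem minTensorNorm_nonneg (x : A ⊗[ℂ] B) : 0 ≤ minTensorNorm x :=
  Real.iSup_nonneg fun _ => ContinuousLinearMap.opNorm_nonneg _

theorem HilbertRep.tensor_comm (π : HilbertRep B) (σ : HilbertRep A) (x : A ⊗[ℂ] B)
    (v : σ.space ⊗[ℂ] π.space) :
    π.tensor σ (TensorProduct.comm ℂ A B x) (TensorProduct.comm ℂ _ _ v) =
      TensorProduct.comm ℂ _ _ (σ.tensor π x v) := by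
  induction x using TensorProduct.induction_on with
  | zero => simp
  | add x y hx hy => simp only [map_add, add_apply, hx, hy]
  | tmul a b =>
    induction v using TensorProduct.induction_on with
    | zero => simp
    | add v w hv hw => simp only [map_add, hv, hw]
    | tmul v w => rfl

/-- The flip of Hilbert spaces is isometric. It reconciles the order of factors in (i) with that in
the definition of exactness. -/
theorem minTensorNorm_comm_le (x : A ⊗[ℂ] B) :
    minTensorNorm (TensorProduct.comm ℂ A B x) ≤ minTensorNorm x := by
  refine ciSup_le fun ρ => ?_
  refine ContinuousLinearMap.opNorm_le_bound _ (minTensorNorm_nonneg x) fun w => ?_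
  obtain ⟨v, rfl⟩ := (TensorProduct.comm ℂ _ _).surjective w
  rw [HilbertRep.tensor_comm, TensorProduct.norm_comm, TensorProduct.norm_comm]
  exact (ContinuousLinearMap.le_opNorm _ _).trans
    (mul_le_mul_of_nonneg_right (norm_tensor_le _ _ x) (norm_nonneg _))

theorem minTensorNorm_smul_le (c : ℂ) (x : A ⊗[ℂ] B) :
    minTensorNorm (c • x) ≤ ‖c‖ * minTensorNorm x := by
  refine ciSup_le fun ρ => ?_
  rw [map_smul]
  exact (ContinuousLinearMap.opNorm_smul_le c _).trans
    (mul_le_mul_of_nonneg_left (norm_tensor_le _ _ x) (norm_nonneg _))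

/-- The scalar action makes the completions Banach spaces, as the open mapping theorem requires. -/
instance : NormedSpace ℂ (AlgMinTensor A B) where
  smul c x := (c • (show A ⊗[ℂ] B from x) : A ⊗[ℂ] B)
  one_smul x := one_smul ℂ (show A ⊗[ℂ] B from x)
  mul_smul c d x := mul_smul c d (show A ⊗[ℂ] B from x)
  smul_zero c := smul_zero (A := A ⊗[ℂ] B) c
  smul_add c x y := smul_add c (show A ⊗[ℂ] B from x) y
  add_smul c d x := add_smul c d (show A ⊗[ℂ] B from x)
  zero_smul x := zero_smul ℂ (show A ⊗[ℂ] B from x)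
  norm_smul_le c x := minTensorNorm_smul_le c x

end NonUnital

section Unital

variable [CStarAlgebra A] [CStarAlgebra B]

theorem HilbertRep.tensor_mul (π : HilbertRep A) (σ : HilbertRep B) (x y : A ⊗[ℂ] B)
    (v : π.space ⊗[ℂ] σ.space) :
    π.tensor σ (x * y) v = π.tensor σ x (π.tensor σ y v) := by
  induction x using TensorProduct.induction_on with
  | zero => simp
  | add x x' hx hx' => simp only [add_mul, map_add, add_apply, hx, hx']
  | tmul a b =>
    induction y using TensorProduct.induction_on with
    | zero => simp
    | add y y' hy hy' => simp only [mul_add, map_add, add_apply, hy, hy']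
    | tmul c d =>
      induction v using TensorProduct.induction_on with
      | zero => simp
      | add v w hv hw => simp only [map_add, hv, hw]
      | tmul v w =>
        rw [Algebra.TensorProduct.tmul_mul_tmul, HilbertRep.tensor_tmul_tmul,
          HilbertRep.tensor_tmul_tmul, HilbertRep.tensor_tmul_tmul, map_mul, map_mul]
        rfl

theorem minTensorNorm_mul_le (x y : A ⊗[ℂ] B) :
    minTensorNorm (x * y) ≤ minTensorNorm x * minTensorNorm y := by
  refine ciSup_le fun ρ => ?_
  refine ContinuousLinearMap.opNorm_le_bound _
    (mul_nonneg (minTensorNorm_nonneg x) (minTensorNorm_nonneg y)) fun v => ?_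
  rw [HilbertRep.tensor_mul, mul_assoc]
  refine (ContinuousLinearMap.le_opNorm _ _).trans (mul_le_mul (norm_tensor_le _ _ x) ?_
    (norm_nonneg _) (minTensorNorm_nonneg x))
  exact (ContinuousLinearMap.le_opNorm _ _).trans
    (mul_le_mul_of_nonneg_right (norm_tensor_le _ _ y) (norm_nonneg _))

theorem HilbertRep.inner_tensor_star (π : HilbertRep A) (σ : HilbertRep B) (x : A ⊗[ℂ] B)
    (v w : π.space ⊗[ℂ] σ.space) :
    inner ℂ (π.tensor σ (star x) v) w = inner ℂ v (π.tensor σ x w) := by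
  induction x using TensorProduct.induction_on with
  | zero => simp
  | add x x' hx hx' =>
    simp only [star_add, map_add, add_apply, hx, hx', inner_add_left,
      inner_add_right]
  | tmul a b =>
    induction v using TensorProduct.induction_on with
    | zero => simp
    | add v v' hv hv' => simp only [map_add, inner_add_left, hv, hv']
    | tmul v v' =>
      induction w using TensorProduct.induction_on with
      | zero => simp
      | add w w' hw hw' => simp only [map_add, inner_add_right, hw, hw']
      | tmul w w' =>
        rw [TensorProduct.star_tmul, HilbertRep.tensor_tmul_tmul, HilbertRep.tensor_tmul_tmul,
          TensorProduct.inner_tmul, TensorProduct.inner_tmul, map_star, map_star,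
          ContinuousLinearMap.star_eq_adjoint, ContinuousLinearMap.star_eq_adjoint,
          ContinuousLinearMap.adjoint_inner_left, ContinuousLinearMap.adjoint_inner_left]

/-- The algebraic tensor product of Hilbert spaces need not be complete, so the formal adjoint
relation and Cauchy–Schwarz take the place of adjoint operators. -/
theorem minTensorNorm_star_le (x : A ⊗[ℂ] B) : minTensorNorm (star x) ≤ minTensorNorm x := by
  refine ciSup_le fun ρ => ?_
  refine ContinuousLinearMap.opNorm_le_bound _ (minTensorNorm_nonneg x) fun v => ?_
  set y := ρ.1.tensor ρ.2 (star x) v with hy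
  have h1 : ‖y‖ * ‖y‖ ≤ ‖v‖ * (minTensorNorm x * ‖y‖) := by
    rw [← inner_self_eq_norm_mul_norm (𝕜 := ℂ) y]
    nth_rewrite 1 [hy]
    rw [HilbertRep.inner_tensor_star]
    refine (re_inner_le_norm _ _).trans (mul_le_mul_of_nonneg_left ?_ (norm_nonneg v))
    exact (ContinuousLinearMap.le_opNorm _ _).trans
      (mul_le_mul_of_nonneg_right (norm_tensor_le _ _ x) (norm_nonneg _))
  rcases (norm_nonneg y).eq_or_lt with h0 | h0
  · rw [← h0]
    exact mul_nonneg (minTensorNorm_nonneg x) (norm_nonneg _)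
  · refine le_of_mul_le_mul_right (h1.trans_eq ?_) h0
    ring

theorem minTensorNorm_pow_two_pow_le (x : A ⊗[ℂ] B) (n : ℕ) :
    minTensorNorm (x ^ 2 ^ n) ≤ minTensorNorm x ^ 2 ^ n := by
  induction n with
  | zero => simp
  | succ n ih =>
    rw [pow_succ, pow_mul, pow_mul, sq, sq]
    exact (minTensorNorm_mul_le _ _).trans
      (mul_le_mul ih ih (minTensorNorm_nonneg _) (pow_nonneg (minTensorNorm_nonneg _) _))

end Unital

end MinNorm

/-- The constant `K` disappears on taking roots of order `2 ^ n`. -/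
theorem le_of_forall_pow_two_pow_le {a b K : ℝ} (ha : 0 ≤ a) (hb : 0 ≤ b)
    (h : ∀ n : ℕ, a ^ 2 ^ n ≤ K * b ^ 2 ^ n) : a ≤ b := by
  by_contra! hlt
  have ha' : 0 < a := hb.trans_lt hlt
  have h1 : Tendsto (fun n : ℕ => K * (b / a) ^ 2 ^ n) atTop (𝓝 (K * 0)) :=
    ((tendsto_pow_atTop_nhds_zero_of_lt_one (div_nonneg hb ha) ((div_lt_one ha').2 hlt)).comp
      (tendsto_pow_atTop_atTop_of_one_lt one_lt_two)).const_mul K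
  rw [mul_zero] at h1
  have h2 : ∀ n : ℕ, (1 : ℝ) ≤ K * (b / a) ^ 2 ^ n := fun n => by
    rw [div_pow, mul_div_assoc', le_div_iff₀ (by positivity), one_mul]
    exact h n
  have := ge_of_tendsto' h1 h2
  linarith

/-- The open mapping theorem for continuous additive maps. -/
theorem NormedAddGroupHom.exists_preimage_norm_le {E F : Type*} [NormedAddCommGroup E]
    [NormedSpace ℝ E] [CompleteSpace E] [NormedAddCommGroup F] [NormedSpace ℝ F] [CompleteSpace F]
    (f : NormedAddGroupHom E F) (hf : Function.Surjective f) :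
    ∃ K > 0, ∀ y, ∃ x, f x = y ∧ ‖x‖ ≤ K * ‖y‖ :=
  (f.toAddMonoidHom.toRealLinearMap f.continuous).exists_preimage_norm_le hf

/-! ### Boundedness from exactness, and automatic contractivity -/

section Exactness

variable {B C D N : Type u} [CStarAlgebra B] [CStarAlgebra C] [CStarAlgebra D] [CStarAlgebra N]

/-- A *-homomorphism on an algebraic tensor product that is bounded for the minimal norm is
contractive. -/
theorem norm_le_minTensorNorm_of_bounded (Ψ : C ⊗[ℂ] B →ₐ[ℂ] N)
    (hstar : ∀ x, Ψ (star x) = star (Ψ x)) {K : ℝ} (hK : 0 ≤ K)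
    (h : ∀ x, ‖Ψ x‖ ≤ K * minTensorNorm x) (x : C ⊗[ℂ] B) : ‖Ψ x‖ ≤ minTensorNorm x := by
  have h0 := minTensorNorm_nonneg x
  have hy : Ψ (star x * x) = star (Ψ x) * Ψ x := by rw [map_mul, hstar]
  -- For self-adjoint elements the C*-norm is multiplicative on powers `2 ^ n`, so the bound `K`
  -- applied to high powers gives the bound `1`.
  have key : ‖Ψ (star x * x)‖ ≤ minTensorNorm x ^ 2 := by
    refine le_of_forall_pow_two_pow_le (K := K) (norm_nonneg _) (sq_nonneg _) fun n => ?_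
    have hsa : IsSelfAdjoint (Ψ (star x * x)) := by rw [hy]; exact .star_mul_self _
    have h1 : ‖Ψ (star x * x)‖ ^ 2 ^ n = ‖Ψ ((star x * x) ^ 2 ^ n)‖ := by
      rw [map_pow]
      exact congrArg NNReal.toReal (hsa.nnnorm_pow_two_pow n).symm
    rw [h1]
    refine (h _).trans (mul_le_mul_of_nonneg_left ?_ hK)
    refine (minTensorNorm_pow_two_pow_le _ n).trans (pow_le_pow_left₀ (minTensorNorm_nonneg _) ?_ _)
    rw [sq]
    exact (minTensorNorm_mul_le _ _).trans
      (mul_le_mul_of_nonneg_right (minTensorNorm_star_le x) h0)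
  rw [hy, CStarRing.norm_star_mul_self, ← sq] at key
  exact (pow_le_pow_iff_left₀ (norm_nonneg _) h0 two_ne_zero).1 key

/-- The kernel of a *-homomorphism. -/
def starKer (φ : D →⋆ₙₐ[ℂ] B) : NonUnitalStarSubalgebra ℂ D where
  carrier := {d | φ d = 0}
  mul_mem' {a b} ha hb := by
    change φ (a * b) = 0
    rw [map_mul, show φ a = 0 from ha, zero_mul]
  add_mem' {a b} ha hb := by
    change φ (a + b) = 0
    rw [map_add, show φ a = 0 from ha, show φ b = 0 from hb, add_zero]
  zero_mem' := map_zero φ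
  smul_mem' c a ha := by
    change φ (c • a) = 0
    rw [map_smul, show φ a = 0 from ha, smul_zero]
  star_mem' {a} ha := by
    change φ (star a) = 0
    rw [map_star, show φ a = 0 from ha, star_zero]

instance isClosed_starKer (φ : D →⋆ₙₐ[ℂ] B) : IsClosed (starKer φ : Set D) :=
  isClosed_eq (AddMonoidHomClass.continuous_of_bound φ 1 fun d => by
    rw [one_mul]; exact NonUnitalStarAlgHom.norm_apply_le φ d) continuous_const

/-- For exact `C`, a map on `C ⊗ D / J` that is contractive on `C ⊗ D` is bounded. -/
theorem exists_bound_of_exact (hC : IsExactCStarAlgebra C) (q : D →⋆ₙₐ[ℂ] B)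
    (hq : Function.Surjective q) (Ψ : C ⊗[ℂ] B →ₗ[ℂ] N)
    (h : ∀ z : C ⊗[ℂ] D, ‖Ψ (LinearMap.lTensor C (q : D →ₗ[ℂ] B) z)‖ ≤ minTensorNorm z) :
    ∃ K, 0 ≤ K ∧ ∀ x, ‖Ψ x‖ ≤ K * minTensorNorm x := by
  let i : starKer q →⋆ₙₐ[ℂ] D := NonUnitalStarSubalgebraClass.subtype (starKer q)
  obtain ⟨-, hex, hsurj⟩ := hC (starKer q) D B i q Subtype.val_injective
    (fun y => ⟨fun hy => ⟨⟨y, hy⟩, rfl⟩, by rintro ⟨y, rfl⟩; exact y.2⟩) hq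
  let Φ : NormedAddGroupHom (AlgMinTensor C D) N :=
    { toFun := fun z => Ψ (LinearMap.lTensor C (q : D →ₗ[ℂ] B) z)
      map_add' := fun x y =>
        map_add (Ψ ∘ₗ LinearMap.lTensor C (q : D →ₗ[ℂ] B)) (show C ⊗[ℂ] D from x) y
      bound' := ⟨1, fun z => (h z).trans_eq (one_mul _).symm⟩ }
  have hqi : ∀ z : C ⊗[ℂ] starKer q,
      Ψ (LinearMap.lTensor C (q : D →ₗ[ℂ] B) (LinearMap.lTensor C (i : starKer q →ₗ[ℂ] D) z)) = 0 := by
    intro z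
    have h0 : (q : D →ₗ[ℂ] B) ∘ₗ (i : starKer q →ₗ[ℂ] D) = 0 := LinearMap.ext fun d => d.2
    rw [← LinearMap.comp_apply (LinearMap.lTensor C _), ← LinearMap.lTensor_comp, h0,
      LinearMap.lTensor_zero, LinearMap.zero_apply, map_zero]
  have hΦi : ∀ z, Φ.extension (MinTensor.lTensor C i z) = 0 := fun z => by
    induction z using UniformSpace.Completion.induction_on with
    | hp =>
      exact isClosed_eq (Φ.extension.continuous.comp (MinTensor.lTensor C i).continuous)
        continuous_const
    | ih z =>
      rw [MinTensor.lTensor, NormedAddGroupHom.completion_coe, NormedAddGroupHom.extension_coe]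
      exact hqi z
  -- The open mapping theorem provides lifts with norm control, but only in the completion; the map
  -- on algebraic tensors is therefore extended there.
  obtain ⟨K, hK, hlift⟩ := NormedAddGroupHom.exists_preimage_norm_le (MinTensor.lTensor C q) hsurj
  refine ⟨‖Φ.extension‖ * K, mul_nonneg (NormedAddGroupHom.opNorm_nonneg _) hK.le, fun x => ?_⟩
  obtain ⟨z₀, rfl⟩ := LinearMap.lTensor_surjective C (g := (q : D →ₗ[ℂ] B)) hq x
  let z₁ : AlgMinTensor C D := z₀
  obtain ⟨z, hz, hzK⟩ := hlift ((AlgMinTensor.lTensor C q z₁ : AlgMinTensor C B) : MinTensor C B)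
  -- The controlled lift `z` and the algebraic lift `z₁` differ by an element of the kernel. By
  -- exactness it comes from `C ⊗ J`, where the extension of `Φ` vanishes.
  have hker : MinTensor.lTensor C q (z - (z₁ : MinTensor C D)) = 0 := by
    refine (map_sub (MinTensor.lTensor C q) z z₁).trans (sub_eq_zero.2 (hz.trans ?_))
    rw [MinTensor.lTensor, NormedAddGroupHom.completion_coe]
  obtain ⟨j, hj⟩ := (hex _).1 hker
  have h1 : Φ.extension z = Φ.extension (z₁ : MinTensor C D) := by
    refine sub_eq_zero.1 ((map_sub Φ.extension z z₁).symm.trans ?_)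
    exact (congrArg Φ.extension hj).symm.trans (hΦi j)
  rw [NormedAddGroupHom.extension_coe] at h1
  change ‖Φ z₁‖ ≤ _
  rw [← h1, mul_assoc]
  refine (Φ.extension.le_opNorm z).trans (mul_le_mul_of_nonneg_left ?_
    (NormedAddGroupHom.opNorm_nonneg _))
  rw [UniformSpace.Completion.norm_coe] at hzK
  exact hzK

end Exactness

/-! ### The multiplication map and passage to the limit -/

section Multiplication

variable {N : Type u} [CStarAlgebra N]

/-- The multiplication map on the tensor product of two commuting subalgebras. -/
def mulHom (C B : StarSubalgebra ℂ N) (h : ∀ b ∈ B, ∀ c ∈ C, b * c = c * b) :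
    C ⊗[ℂ] B →ₐ[ℂ] N :=
  Algebra.TensorProduct.lift C.subtype.toAlgHom B.subtype.toAlgHom fun c b =>
    (h b b.2 c c.2).symm

theorem mulHom_tmul (C B : StarSubalgebra ℂ N) (h : ∀ b ∈ B, ∀ c ∈ C, b * c = c * b)
    (c : C) (b : B) : mulHom C B h (c ⊗ₜ b) = c * b :=
  Algebra.TensorProduct.lift_tmul _ _ _ _ _

theorem mulHom_star (C B : StarSubalgebra ℂ N) (h : ∀ b ∈ B, ∀ c ∈ C, b * c = c * b)
    (x : C ⊗[ℂ] B) : mulHom C B h (star x) = star (mulHom C B h x) := by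
  induction x using TensorProduct.induction_on with
  | zero => simp
  | add x y hx hy => rw [star_add, map_add, map_add, hx, hy, star_add]
  | tmul c b =>
    rw [TensorProduct.star_tmul, mulHom_tmul, mulHom_tmul, star_mul]
    exact (h _ (star_mem b.2) _ (star_mem c.2)).symm

variable {δ : N → ℝ} (hδ : IsDimension δ) (hN : IsBaerStarRing N) (A C : StarSubalgebra ℂ N)
  [hA : IsClosed (A : Set N)]

theorem measClosure_commute (hcomm : ∀ a ∈ A, ∀ c ∈ C, a * c = c * a) :
    ∀ b ∈ measClosure hδ hN A, ∀ c ∈ C, b * c = c * b := by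
  intro b hb c hc
  obtain ⟨a, ha, hM, hab⟩ := exists_seq_of_mem_measClosure hδ hN hb
  have h1 := hab.mul hδ hN (.const hδ c) hM
  have h2 := (TendstoInMeas.const hδ c).mul hδ hN hab (M := ‖c‖) fun _ => le_rfl
  refine h1.unique hδ hN ?_
  simpa only [hcomm _ (ha _) c hc] using h2

/-- The limit in measure, as a map onto its range. -/
def limHomRange : ConvSeq hδ hN A →⋆ₙₐ[ℂ] measClosure hδ hN A :=
  { toFun := fun d => ⟨limHom hδ hN A d, d, rfl⟩
    map_smul' := fun c d => Subtype.ext (map_smul (limHom hδ hN A) c d)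
    map_zero' := Subtype.ext (map_zero (limHom hδ hN A))
    map_add' := fun d d' => Subtype.ext (map_add (limHom hδ hN A) d d')
    map_mul' := fun d d' => Subtype.ext (map_mul (limHom hδ hN A) d d')
    map_star' := fun d => Subtype.ext (map_star (limHom hδ hN A) d) }

theorem limHomRange_surjective : Function.Surjective (limHomRange hδ hN A) := by
  rintro ⟨_, d, rfl⟩
  exact ⟨d, rfl⟩

/-- Evaluation of a sequence at `n`, as a non-unital *-homomorphism. -/
def evalHomNonUnital (n : ℕ) : ConvSeq hδ hN A →⋆ₙₐ[ℂ] A :=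
  (evalHom hδ hN A n : ConvSeq hδ hN A →⋆ₙₐ[ℂ] A)

/-- By additivity it suffices to treat an elementary tensor, where a constant in `C` multiplies a
sequence converging in measure. -/
theorem tendsto_mulHom (hcomm : ∀ a ∈ A, ∀ c ∈ C, a * c = c * a)
    (z : C ⊗[ℂ] ConvSeq hδ hN A) :
    TendstoInMeas δ
      (fun n => mulHom C A hcomm (LinearMap.lTensor C
        (evalHomNonUnital hδ hN A n : ConvSeq hδ hN A →ₗ[ℂ] A) z))
      (mulHom C (measClosure hδ hN A) (measClosure_commute hδ hN A C hcomm) (LinearMap.lTensor C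
        (limHomRange hδ hN A : ConvSeq hδ hN A →ₗ[ℂ] measClosure hδ hN A) z)) := by
  induction z using TensorProduct.induction_on with
  | zero => simpa only [map_zero] using TendstoInMeas.const hδ 0
  | add x y hx hy => simpa only [map_add] using hx.add hδ hN hy
  | tmul c d =>
    simp only [LinearMap.lTensor_tmul, mulHom_tmul]
    exact (TendstoInMeas.const hδ (c : N)).mul hδ hN (tendsto_limHom hδ hN d)
      (M := ‖(c : N)‖) fun _ => le_rfl

variable [hC : IsClosed (C : Set N)]

theorem norm_mulHom_le (hcomm : ∀ a ∈ A, ∀ c ∈ C, a * c = c * a)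
    (hmin : ∀ (l : ℕ) (a : Fin l → A) (c : Fin l → C),
      ‖∑ i, (a i : N) * (c i : N)‖ ≤ minTensorNorm (∑ i, a i ⊗ₜ[ℂ] c i))
    (x : C ⊗[ℂ] A) : ‖mulHom C A hcomm x‖ ≤ minTensorNorm x := by
  obtain ⟨l, c, a, rfl⟩ := TensorProduct.exists_sum_tmul_eq x
  have h1 := minTensorNorm_comm_le (∑ j, c j ⊗ₜ[ℂ] a j)
  have h2 : TensorProduct.comm ℂ C A (∑ j, c j ⊗ₜ[ℂ] a j) = ∑ j, a j ⊗ₜ[ℂ] c j := by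
    simp only [map_sum, TensorProduct.comm_tmul]
  have h3 : mulHom C A hcomm (∑ j, c j ⊗ₜ[ℂ] a j) = ∑ j, (a j : N) * (c j : N) := by
    rw [map_sum]
    exact Finset.sum_congr rfl fun j _ => by
      rw [mulHom_tmul, hcomm _ (a j).2 _ (c j).2]
  rw [h3]
  rw [h2] at h1
  exact (hmin l a c).trans h1

/-- Along each evaluation the product is bounded by the minimal norm of the tensor over sequences,
and semicontinuity carries the bound to the limit. Exactness then descends it to the range up to a
constant, and contractivity removes the constant. -/
theorem norm_mulHom_measClosure_le (hcomm : ∀ a ∈ A, ∀ c ∈ C, a * c = c * a)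
    (hmin : ∀ (l : ℕ) (a : Fin l → A) (c : Fin l → C),
      ‖∑ i, (a i : N) * (c i : N)‖ ≤ minTensorNorm (∑ i, a i ⊗ₜ[ℂ] c i))
    (hexact : IsExactCStarAlgebra C) [IsClosed (measClosure hδ hN A : Set N)]
    (x : C ⊗[ℂ] measClosure hδ hN A) :
    ‖mulHom C (measClosure hδ hN A) (measClosure_commute hδ hN A C hcomm) x‖ ≤ minTensorNorm x := by
  obtain ⟨K, hK, h⟩ := exists_bound_of_exact hexact (limHomRange hδ hN A)
    (limHomRange_surjective hδ hN A)
    (mulHom C (measClosure hδ hN A) (measClosure_commute hδ hN A C hcomm)).toLinearMap fun z =>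
      (tendsto_mulHom hδ hN A C hcomm z).norm_le hδ hN fun n =>
        (norm_mulHom_le A C hcomm hmin _).trans
          (minTensorNorm_lTensor_le (evalHomNonUnital hδ hN A n) z)
  exact norm_le_minTensorNorm_of_bounded _ (mulHom_star _ _ _) hK h x

end Multiplication

theorem isClosed_awStarClosure {N : Type*} [CStarAlgebra N] (A : StarSubalgebra ℂ N) :
    IsClosed (awStarClosure A : Set N) := by
  rw [awStarClosure, StarSubalgebra.coe_sInf]
  exact isClosed_biInter fun S hS => hS.1.1

end

theorem lemma5p8 {N : Type u} [CStarAlgebra N]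
    (hAW : IsBaerStarRing N) (hfin : IsFiniteStarRing N)
    (τ : N → ℂ) (hτ : IsQuasitrace τ) (hτf : IsFaithfulQuasitrace τ) (hτn : IsNormalQuasitrace τ)
    (A C : StarSubalgebra ℂ N) (hA : IsClosed (A : Set N)) [hC : IsClosed (C : Set N)]
    (hcomm : ∀ a ∈ A, ∀ c ∈ C, a * c = c * a)
    (hmin : ∀ (l : ℕ) (a : Fin l → A) (c : Fin l → C),
      ‖∑ i, (a i : N) * (c i : N)‖ ≤ minTensorNorm (∑ i, a i ⊗ₜ[ℂ] c i))
    (hexact : IsExactCStarAlgebra C) :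
    ∀ (l : ℕ) (b : Fin l → awStarClosure A) (c : Fin l → C),
      ‖∑ i, (b i : N) * (c i : N)‖ ≤ minTensorNorm (∑ i, b i ⊗ₜ[ℂ] c i) := by
  intro l b c
  have hδ := hτ.isDimension hτf hτn
  have _ := isClosed_measClosure hδ hAW A
  have _ := isClosed_awStarClosure A
  have hle := awStarClosure_le_measClosure hδ hAW A
  -- The estimate holds over the possibly larger closure in measure; it restricts because the
  -- inclusion does not increase the minimal norm.
  let j : awStarClosure A →⋆ₙₐ[ℂ] measClosure hδ hAW A :=
    (StarSubalgebra.inclusion hle : awStarClosure A →⋆ₙₐ[ℂ] measClosure hδ hAW A)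
  have hsum : ∑ i, (b i : N) * (c i : N) =
      mulHom C (measClosure hδ hAW A) (measClosure_commute hδ hAW A C hcomm)
        (∑ i, c i ⊗ₜ[ℂ] j (b i)) := by
    rw [map_sum]
    refine Finset.sum_congr rfl fun i _ => ?_
    rw [mulHom_tmul]
    exact measClosure_commute hδ hAW A C hcomm _ (hle (b i).2) _ (c i).2
  have hmap : ∑ i, c i ⊗ₜ[ℂ] j (b i) =
      LinearMap.lTensor C (j : awStarClosure A →ₗ[ℂ] measClosure hδ hAW A)
        (TensorProduct.comm ℂ (awStarClosure A) C (∑ i, b i ⊗ₜ[ℂ] c i)) := by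
    simp only [map_sum, TensorProduct.comm_tmul, LinearMap.lTensor_tmul]
    rfl
  rw [hsum]
  refine (norm_mulHom_measClosure_le hδ hAW A C hcomm hmin hexact _).trans ?_
  rw [hmap]
  exact (minTensorNorm_lTensor_le j _).trans (minTensorNorm_comm_le _)
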